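/- Let $k$ be a field and let $1\le a<b\le c<e<d$ be integers such that $d-e\ge a$ and $b-a\ge e-c$. Let $$R=k[x^{\alpha}y^{d-\alpha}\mid \alpha\in[0,a]\cup[b,c]\cup[e,d]]\subseteq k[x,y]$$ (integer intervals), graded so that the given monomial generators have degree $1$; let $R_+=\bigoplus_{n\ge1}R_n$ and $Q=(x^d,y^d)R$. Then $Q$ is a reduction of $R_+$, i.e. $QR_+^{\,r}=R_+^{\,r+1}$ for some $r\ge 0$, and, writing $r_Q(R_+)$ for the least such $r$, $$\operatorname{reg}(R)=r_Q(R_+)=\left\lceil\frac{b-1}{a}\right\rceil .$$ Here $\operatorname{reg}(R)=\max_i\{b_i-i\}$ is the Castelnuovo-Mumford regularity, where $b_i$ is the maximal degree of a generator of $F_i$ in a (finite) minimal graded free resolution $0\to F_p\to\cdots\to F_0\to R\to0$ over the standard graded polynomial ring $S=k[X_\alpha \mid \alpha\in[0,a]\cup[b,c]\cup[e,d]]$, which maps onto $R$ by $X_\alpha\mapsto x^\alpha y^{d-\alpha}$. -/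

import Mathlib

/-- `J` is a reduction of the ideal `I`: `J ⊆ I` and `J * I ^ r = I ^ (r + 1)` for some `r`. -/
def IsReduction {R : Type*} [CommRing R] (J I : Ideal R) : Prop :=
  J ≤ I ∧ ∃ r : ℕ, J * I ^ r = I ^ (r + 1)

/-- The reduction number `r_J(I)` of `I` with respect to a reduction `J`: the least `r` with
`J * I ^ r = I ^ (r + 1)`. (Meaningful when `IsReduction J I` holds.) -/
noncomputable def reductionNumber {R : Type*} [CommRing R] (J I : Ideal R) : ℕ :=
  sInf {r : ℕ | J * I ^ r = I ^ (r + 1)}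

/-- A finite minimal graded free resolution `0 → F_p → ⋯ → F_1 → F_0 → R → 0` of a graded
algebra `R = ⨁ 𝒜 n` over the standard graded polynomial ring `S = k[X_s : s ∈ σ]`, where `R` is
an `S`-module through `φ : S → R`.

`F_i` is the free module `S ^ rank i` whose `j`-th basis vector has degree `degree i j`; the
differential `F_{i+1} → F_i` is multiplication by the matrix `D i`, and the augmentation
`F_0 → R` sends the `j`-th basis vector to `gen j`. As `R` has no nonzero elements of negative
degree, neither has any basis vector of a minimal resolution, so degrees are natural numbers. -/
structure MinimalGradedFreeResolution {k σ R : Type*} [Field k] [CommRing R] [Algebra k R]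
    (φ : MvPolynomial σ k →ₐ[k] R) (𝒜 : ℕ → Submodule k R) where
  /-- the rank of `F_i` -/
  rank : ℕ → ℕ
  /-- the degrees of the basis vectors of `F_i` -/
  degree : (i : ℕ) → Fin (rank i) → ℕ
  /-- the images in `R` of the basis vectors of `F_0` -/
  gen : Fin (rank 0) → R
  /-- the matrix of the differential `F_{i+1} → F_i` -/
  D : (i : ℕ) → Matrix (Fin (rank i)) (Fin (rank (i + 1))) (MvPolynomial σ k)
  finite_length : ∃ p : ℕ, ∀ i, p < i → rank i = 0
  gen_mem : ∀ j, gen j ∈ 𝒜 (degree 0 j)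
  D_homogeneous : ∀ i j l, D i j l = 0 ∨
    ∃ m : ℕ, degree i j + m = degree (i + 1) l ∧ (D i j l).IsHomogeneous m
  surjective : Function.Surjective
    (fun v : Fin (rank 0) → MvPolynomial σ k => ∑ j, φ (v j) * gen j)
  exact_zero : Function.Exact (fun w => (D 0).mulVec w)
    (fun v : Fin (rank 0) → MvPolynomial σ k => ∑ j, φ (v j) * gen j)
  exact_succ : ∀ i, Function.Exact (fun w => (D (i + 1)).mulVec w) (fun v => (D i).mulVec v)
  /-- every differential maps into `(X_s : s ∈ σ) F_i` -/
  minimal : ∀ i j l, MvPolynomial.constantCoeff (D i j l) = 0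

/-- The Castelnuovo-Mumford regularity of `R` is `m`: there is a finite minimal graded free
resolution of `R` over the polynomial ring, and for every such resolution the maximum of
`b_i - i` is `m`, where `b_i` is the largest degree of a basis vector of `F_i`. -/
def HasRegularity {k σ R : Type*} [Field k] [CommRing R] [Algebra k R]
    (φ : MvPolynomial σ k →ₐ[k] R) (𝒜 : ℕ → Submodule k R) (m : ℤ) : Prop :=
  Nonempty (MinimalGradedFreeResolution φ 𝒜) ∧
    ∀ F : MinimalGradedFreeResolution φ 𝒜,
      IsGreatest {z : ℤ | ∃ (i : ℕ) (j : Fin (F.rank i)), z = (F.degree i j : ℤ) - i} m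

namespace MonomialCurve

/-- The monomial `x ^ α * y ^ (d - α)` of `k[x, y]`. -/
noncomputable def mono (k : Type*) [Field k] (d α : ℕ) : MvPolynomial (Fin 2) k :=
  MvPolynomial.X 0 ^ α * MvPolynomial.X 1 ^ (d - α)

/-- The coordinate ring `R = k[x ^ α * y ^ (d - α) | α ∈ A] ⊆ k[x, y]`. -/
noncomputable def ring (k : Type*) [Field k] (d : ℕ) (A : Set ℕ) :
    Subalgebra k (MvPolynomial (Fin 2) k) :=
  Algebra.adjoin k (mono k d '' A)

/-- The graded component `R_n`: the elements of `R` that are forms of degree `n * d` in `x, y`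
(so that the given generators have degree one). -/
noncomputable def component (k : Type*) [Field k] (d : ℕ) (A : Set ℕ) (n : ℕ) :
    Submodule k (ring k d A) :=
  (MvPolynomial.homogeneousSubmodule (Fin 2) k (n * d)).comap (ring k d A).val.toLinearMap

/-- The ideal `R_+ = ⨁_{n ≥ 1} R_n`. -/
noncomputable def irrelevant (k : Type*) [Field k] (d : ℕ) (A : Set ℕ) : Ideal (ring k d A) :=
  Ideal.span {f | ∃ n : ℕ, 1 ≤ n ∧ f ∈ component k d A n}

/-- The generator of `R` with exponent `α ∈ A`, as an element of `R`. -/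
noncomputable def generator (k : Type*) [Field k] (d : ℕ) (A : Set ℕ) (α : A) : ring k d A :=
  ⟨mono k d α, Algebra.subset_adjoin (Set.mem_image_of_mem _ α.2)⟩

/-- The ideal `Q = (x ^ d, y ^ d)` of `R`, provided that `x ^ d` and `y ^ d` are among the
given generators. -/
noncomputable def idealQ (k : Type*) [Field k] (d : ℕ) (A : Set ℕ) (h0 : 0 ∈ A) (hd : d ∈ A) :
    Ideal (ring k d A) :=
  Ideal.span {generator k d A ⟨d, hd⟩, generator k d A ⟨0, h0⟩}

/-- The presentation `S = k[X_α : α ∈ A] → R`, `X_α ↦ x ^ α * y ^ (d - α)`. -/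
noncomputable def presentation (k : Type*) [Field k] (d : ℕ) (A : Set ℕ) :
    MvPolynomial A k →ₐ[k] ring k d A :=
  MvPolynomial.aeval (generator k d A)

/-- The exponents in `[0, a] ∪ [b, c] ∪ [e, d]`. -/
def threeIntervals (a b c d e : ℕ) : Set ℕ :=
  Set.Icc 0 a ∪ Set.Icc b c ∪ Set.Icc e d

theorem zero_mem_threeIntervals (a b c d e : ℕ) : 0 ∈ threeIntervals a b c d e :=
  Or.inl (Or.inl ⟨le_rfl, Nat.zero_le a⟩)

theorem last_mem_threeIntervals (a b c : ℕ) {d e : ℕ} (h : e < d) :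
    d ∈ threeIntervals a b c d e :=
  Or.inr ⟨h.le, le_rfl⟩

end MonomialCurve

/-! Let m = ⌈(b-1)/a⌉, the least integer with b ≤ ma + 1. Two facts about exponents carry
everything. For n ≥ m, every integer in [0, nd] is a sum of n exponents of generators
(`sumOf_of_le`), so from degree m on R contains all forms of degree nd, and they lie in the n-th
power of R_+. On the other hand the monomial of degree m with x-exponent (m-1)a + 1 is not in Q: x^d
does not divide it, and its quotient by y^d would have degree m-1 and an exponent in the gap between
(m-1)a and b (`not_mem_idealQ`).

Reduction number: a form of degree (n+1)d with n ≥ 1 is x^d g + y^d h, and g, h are in R once n ≥ m.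
Hence Q R_+^m = R_+^(m+1), while equality at some r < m would put R_+^m inside Q.

Regularity: the basis degrees of F_i in a minimal resolution are the degrees in which the i-th
Koszul homology of the variables on R is nonzero (`Resolution.vanish_iff`, by dimension shifting).
Sort this homology into strands, q being internal minus homological degree; the regularity is the
last nonzero strand. For x^d, y^d alone the strands above m vanish, since these elements are a
regular sequence in k[x,y] and the quotients that occur have degree at least m (`Saturated.vanish`);
strand m is nonzero because of the monomial outside Q. Adding further elements of degree one does
not move the last nonzero strand (`vanish_append`).

A resolution is built by repeatedly choosing a least number of homogeneous generators of the
syzygies; it is finite because Koszul homology vanishes beyond the number of variables. -/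

namespace Koszul

/-! ### Koszul complexes as iterated mapping cones, sorted into strands -/

section Complex

/-- The restriction of a family to the lists that start with `s`. -/
def part {M : Type*} (s : Bool) (ω : List Bool → M) : List Bool → M := fun t => ω (s :: t)

theorem ext_parts {M : Type*} {v w : List Bool → M} (h : v [] = w [])
    (h0 : part false v = part false w)
    (h1 : part true v = part true w) : v = w := by
  funext t
  match t with
  | [] => exact h
  | false :: t => exact congrFun h0 t
  | true :: t => exact congrFun h1 t

variable {S M : Type*} [CommRing S] [AddCommGroup M] [Module S M]

/-- The family on `List Bool` with restrictions `a` to the lists that start with `false` and `b`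
to those that start with `true`. -/
def pair (a b : List Bool → M) : List Bool → M
  | [] => 0
  | false :: t => a t
  | true :: t => b t

@[simp] theorem part_false_pair (a b : List Bool → M) : part false (pair a b) = a := rfl
@[simp] theorem part_true_pair (a b : List Bool → M) : part true (pair a b) = b := rfl
@[simp] theorem part_add (s : Bool) (v w : List Bool → M) :
    part s (v + w) = part s v + part s w := rfl
@[simp] theorem part_smul (s : Bool) (r : S) (v : List Bool → M) :
    part s (r • v) = r • part s v := rfl

/-- The differential of the Koszul complex of a list `xs` of ring elements with coefficients in
`M`, as an iterated mapping cone. A chain is a family of elements of `M` indexed by the boolean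
lists of the length of `xs`. -/
def diff : List S → (List Bool → M) →ₗ[S] (List Bool → M)
  | [] => 0
  | x :: xs =>
    { toFun := fun ω =>
        pair (diff xs (part false ω) + x • part true ω) (-diff xs (part true ω))
      map_add' := fun v w => by
        apply ext_parts
        · simp [pair]
        · simp; abel
        · simp; abel
      map_smul' := fun r v => by
        apply ext_parts
        · simp [pair]
        · simp [smul_comm x r]
        · simp }

@[simp] theorem diff_nil (ω : List Bool → M) : diff ([] : List S) ω = 0 := rfl

theorem diff_cons (x : S) (xs : List S) (ω : List Bool → M) :
    diff (x :: xs) ω =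
      pair (diff xs (part false ω) + x • part true ω) (-diff xs (part true ω)) := rfl

theorem diff_diff (xs : List S) (ω : List Bool → M) : diff xs (diff xs ω) = 0 := by
  induction xs generalizing ω with
  | nil => rfl
  | cons x xs ih =>
    rw [diff_cons, diff_cons]
    apply ext_parts
    · rfl
    · simp only [part_false_pair, part_true_pair, map_add, map_smul, ih, smul_neg]
      simp; rfl
    · simp only [part_true_pair, map_neg, ih]
      simp; rfl

theorem diff_comp {N : Type*} [AddCommGroup N] [Module S N] (f : M →ₗ[S] N) (xs : List S)
    (ω : List Bool → M) : diff xs (f ∘ ω) = f ∘ diff xs ω := by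
  induction xs generalizing ω with
  | nil => funext t; simp
  | cons x xs ih =>
    have h (s : Bool) : part s (f ∘ ω) = f ∘ part s ω := rfl
    rw [diff_cons, diff_cons, h, h, ih, ih]
    funext t
    match t with
    | [] => simp [pair]
    | false :: t => simp [pair]
    | true :: t => simp [pair]

/-- The chains of homological degree `i` with values in `γ q`, for a list of `l` elements. -/
def chains (γ : ℤ → AddSubgroup M) (l : ℕ) (i q : ℤ) : AddSubgroup (List Bool → M) where
  carrier := {ω | ∀ t, ω t ∈ γ q ∧ (ω t ≠ 0 → t.length = l ∧ (t.count true : ℤ) = i)}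
  zero_mem' := fun t => ⟨zero_mem _, fun h => absurd rfl h⟩
  add_mem' := fun {v w} hv hw t => ⟨add_mem (hv t).1 (hw t).1, fun h => by
    by_cases h0 : v t = 0
    · exact (hw t).2 fun h1 => h (by simp [h0, h1])
    · exact (hv t).2 h0⟩
  neg_mem' := fun {v} hv t => ⟨neg_mem (hv t).1, fun h => (hv t).2 fun h0 => h (by simp [h0])⟩

variable {γ : ℤ → AddSubgroup M}

theorem part_false_mem {l : ℕ} {i q : ℤ} {ω : List Bool → M} (h : ω ∈ chains γ (l + 1) i q) :
    part false ω ∈ chains γ l i q := fun t => by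
  simpa [part] using h (false :: t)

theorem part_true_mem {l : ℕ} {i q : ℤ} {ω : List Bool → M} (h : ω ∈ chains γ (l + 1) i q) :
    part true ω ∈ chains γ l (i - 1) q := fun t => by
  have := h (true :: t)
  simp only [List.length_cons, List.count_cons_self, Nat.cast_add, Nat.cast_one] at this
  exact ⟨this.1, fun h0 => ⟨by have := (this.2 h0).1; omega, by have := (this.2 h0).2; omega⟩⟩

theorem apply_nil_of_mem {l : ℕ} {i q : ℤ} {ω : List Bool → M} (h : ω ∈ chains γ (l + 1) i q) :
    ω [] = 0 := by
  by_contra h0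
  simpa using ((h []).2 h0).1

theorem pair_mem {l : ℕ} {i q : ℤ} {v w : List Bool → M} (hv : v ∈ chains γ l i q)
    (hw : w ∈ chains γ l (i - 1) q) : pair v w ∈ chains γ (l + 1) i q := fun t => by
  match t with
  | [] => exact ⟨zero_mem _, fun h => absurd rfl h⟩
  | false :: t => simpa [pair] using hv t
  | true :: t =>
    refine ⟨(hw t).1, fun h0 => ?_⟩
    have := (hw t).2 h0
    simp only [List.length_cons, List.count_cons_self, Nat.cast_add, Nat.cast_one]
    exact ⟨by omega, by omega⟩

/-- Multiplication by `x` raises degrees by one. -/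
def Raises (γ : ℤ → AddSubgroup M) (x : S) : Prop := ∀ q, ∀ r ∈ γ q, x • r ∈ γ (q + 1)

theorem smul_mem_chains {l : ℕ} {i q : ℤ} {x : S} (hx : Raises γ x) {ω : List Bool → M}
    (h : ω ∈ chains γ l i q) : x • ω ∈ chains γ l i (q + 1) := fun t =>
  ⟨hx q _ (h t).1, fun h0 => (h t).2 fun h1 => h0 (by simp [h1])⟩

theorem diff_mem {xs : List S} (hxs : ∀ x ∈ xs, Raises γ x) {i q : ℤ} {ω : List Bool → M}
    (h : ω ∈ chains γ xs.length i q) : diff xs ω ∈ chains γ xs.length (i - 1) (q + 1) := by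
  induction xs generalizing ω i with
  | nil => exact zero_mem _
  | cons x xs ih =>
    rw [List.forall_mem_cons] at hxs
    rw [diff_cons]
    exact pair_mem (add_mem (ih hxs.2 (part_false_mem h))
      (smul_mem_chains hxs.1 (part_true_mem h))) (neg_mem (ih hxs.2 (part_true_mem h)))

/-- `ω` is the boundary of a chain of homological degree `i + 1` in the strand `q - 1`. -/
def IsBoundary (xs : List S) (γ : ℤ → AddSubgroup M) (i q : ℤ) (ω : List Bool → M) : Prop :=
  ∃ η ∈ chains γ xs.length (i + 1) (q - 1), diff xs η = ω

/-- The Koszul homology of `xs` vanishes in homological degree `i` and internal degree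
`i + q`. -/
def Vanish (xs : List S) (γ : ℤ → AddSubgroup M) (i q : ℤ) : Prop :=
  ∀ ω ∈ chains γ xs.length i q, diff xs ω = 0 → IsBoundary xs γ i q ω

theorem isBoundary_zero (xs : List S) (γ : ℤ → AddSubgroup M) (i q : ℤ) :
    IsBoundary xs γ i q 0 := ⟨0, zero_mem _, map_zero _⟩

theorem vanish_of_neg {xs : List S} {i q : ℤ} (hi : i < 0) : Vanish xs γ i q := by
  intro ω hω _
  have : ω = 0 := by
    funext t
    by_contra h
    have := ((hω t).2 h).2
    omega
  exact this ▸ isBoundary_zero ..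

theorem vanish_of_length_lt {xs : List S} {i q : ℤ} (hi : xs.length < i) : Vanish xs γ i q := by
  intro ω hω _
  have : ω = 0 := by
    funext t
    by_contra h
    have h1 := (hω t).2 h
    have h2 : t.count true ≤ t.length := List.count_le_length
    omega
  exact this ▸ isBoundary_zero ..

/-- This is exactness of H_i(xs) → H_i(x, xs) → H_{i-1}(xs) → H_{i-1}(xs), the last map being
multiplication by x; `hb` says that this map is injective on strand q. -/
theorem vanish_cons {x : S} {xs : List S} {i q : ℤ} (hx : Raises γ x)
    (h : Vanish xs γ i q)
    (hb : ∀ ω ∈ chains γ xs.length (i - 1) q, diff xs ω = 0 →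
      (∃ η ∈ chains γ xs.length i q, diff xs η = x • ω) → IsBoundary xs γ (i - 1) q ω) :
    Vanish (x :: xs) γ i q := by
  intro ω hω h0
  rw [diff_cons] at h0
  have ha : diff xs (part false ω) + x • part true ω = 0 := congrArg (part false) h0
  have hb' : -diff xs (part true ω) = 0 := congrArg (part true) h0
  rw [neg_eq_zero] at hb'
  obtain ⟨c, hc, hcd⟩ := hb _ (part_true_mem hω) hb'
    ⟨-part false ω, neg_mem (part_false_mem hω), by
      rw [map_neg]; exact neg_eq_of_add_eq_zero_right ha⟩
  rw [sub_add_cancel] at hc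
  have hxc := smul_mem_chains hx hc
  rw [sub_add_cancel] at hxc
  -- Modulo the boundary of `pair 0 (-c)`, the cycle `ω` lies in the subcomplex of `xs`, where its
  -- value is the chain below.
  obtain ⟨e, he, hed⟩ := h (part false ω + x • c) (add_mem (part_false_mem hω) hxc)
    (by rw [map_add, map_smul, hcd, ha])
  refine ⟨pair e (-c), pair_mem he (neg_mem (by simpa using hc)), ?_⟩
  rw [diff_cons]
  refine ext_parts (apply_nil_of_mem hω).symm ?_ ?_
  · simp [hed]
  · simp [hcd]

theorem vanish_cons_of_vanish {x : S} {xs : List S} {i q : ℤ} (hx : Raises γ x)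
    (h : Vanish xs γ i q) (h' : Vanish xs γ (i - 1) q) : Vanish (x :: xs) γ i q :=
  vanish_cons hx h fun ω hω h0 _ => h' ω hω h0

/-- Multiplication by x sends H_i(xs) in strand q to strand q + 1, which is zero, so every class of
strand q lifts to H_{i+1}(x, xs). The homological degree rises by one and the strand is kept. -/
theorem not_vanish_cons {x : S} {xs : List S} {i q : ℤ} (hx : Raises γ x)
    (h : ¬ Vanish xs γ i q) (h' : Vanish xs γ i (q + 1)) : ¬ Vanish (x :: xs) γ (i + 1) q := by
  intro hv
  apply h
  intro b hb hb0
  obtain ⟨a, ha, had⟩ := h' (x • b) (smul_mem_chains hx hb) (by rw [map_smul, hb0, smul_zero])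
  rw [add_sub_cancel_right] at ha
  obtain ⟨η, hη, hηd⟩ := hv (pair (-a) b) (pair_mem (neg_mem ha) (by simpa using hb)) (by
    rw [diff_cons]
    refine ext_parts rfl ?_ ?_
    · simp [had]; rfl
    · simp [hb0]; rfl)
  have h1 := part_true_mem hη
  rw [add_sub_cancel_right] at h1
  refine ⟨-part true η, neg_mem h1, ?_⟩
  have := congrArg (part true) hηd
  simpa [diff_cons] using this

/-- The strands above `q` of the Koszul homology stay zero, and the strand `q` stays nonzero, when
elements of degree one are added to the list. -/
theorem vanish_append {xs : List S} (ys : List S) (hys : ∀ y ∈ ys, Raises γ y) {q : ℤ}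
    (h : ∀ i p, q < p → Vanish xs γ i p) {i : ℤ} (h0 : ¬ Vanish xs γ i q) :
    (∀ i p, q < p → Vanish (ys ++ xs) γ i p) ∧ ∃ j, ¬ Vanish (ys ++ xs) γ j q := by
  induction ys with
  | nil => exact ⟨h, i, h0⟩
  | cons y ys ih =>
    rw [List.forall_mem_cons] at hys
    obtain ⟨h1, j, h2⟩ := ih hys.2
    exact ⟨fun i p hp => vanish_cons_of_vanish hys.1 (h1 i p hp) (h1 (i - 1) p hp),
      j + 1, not_vanish_cons hys.1 h2 (h1 _ _ (lt_add_one q))⟩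

end Complex

/-! ### Homological degrees zero and one -/

section DegreeZero

variable {S M : Type*} [CommRing S] [AddCommGroup M] [Module S M] {γ : ℤ → AddSubgroup M}

/-- The chain of homological degree zero with value `r`. -/
def single : ℕ → M → (List Bool → M)
  | 0, r => fun t => match t with
    | [] => r
    | _ :: _ => 0
  | l + 1, r => pair (single l r) 0

theorem single_mem {l : ℕ} {q : ℤ} {r : M} (hr : r ∈ γ q) : single l r ∈ chains γ l 0 q := by
  induction l with
  | zero =>
    intro t
    match t with
    | [] => exact ⟨hr, fun _ => by simp⟩
    | _ :: _ => exact ⟨zero_mem _, fun h => absurd rfl h⟩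
  | succ l ih => exact pair_mem ih (zero_mem _)

theorem single_zero (l : ℕ) : single l (0 : M) = 0 := by
  induction l with
  | zero => funext t; cases t <;> rfl
  | succ l ih => rw [single, ih]; exact ext_parts rfl rfl rfl

theorem single_add (l : ℕ) (r s : M) : single l (r + s) = single l r + single l s := by
  induction l with
  | zero => funext t; cases t <;> simp [single]
  | succ l ih => rw [single, ih]; refine ext_parts (by simp [single, pair]) rfl (by simp [single])

theorem single_smul (l : ℕ) (x : S) (r : M) : single l (x • r) = x • single l r := by
  induction l with
  | zero => funext t; cases t <;> simp [single]
  | succ l ih => rw [single, ih]; refine ext_parts (by simp [single, pair]) rfl (by simp [single])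

theorem exists_single {l : ℕ} {q : ℤ} {ω : List Bool → M} (h : ω ∈ chains γ l 0 q) :
    ∃ r ∈ γ q, ω = single l r := by
  induction l generalizing ω with
  | zero =>
    refine ⟨ω [], (h []).1, ?_⟩
    funext t
    match t with
    | [] => rfl
    | s :: t =>
      by_contra h0
      simpa using ((h (s :: t)).2 h0).1
  | succ l ih =>
    obtain ⟨r, hr, h1⟩ := ih (part_false_mem h)
    refine ⟨r, hr, ext_parts (apply_nil_of_mem h) h1 ?_⟩
    funext t
    by_contra h0
    have := ((part_true_mem h t).2 h0).2
    omega

theorem diff_single (xs : List S) (r : M) : diff xs (single xs.length r) = 0 := by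
  induction xs with
  | nil => rfl
  | cons x xs ih =>
    rw [List.length_cons, single, diff_cons]
    exact ext_parts rfl (by simp [ih]; rfl) (by simp; rfl)

/-- `r` is a combination of `xs` with coefficients in `γ q`. -/
def InSpan (γ : ℤ → AddSubgroup M) (q : ℤ) : List S → M → Prop
  | [], r => r = 0
  | x :: xs, r => ∃ c ∈ γ q, InSpan γ q xs (r - x • c)

/-- The `true` part of a 1-chain is a 0-chain, that is, one ring or module element: the coefficient
of the head of the list. -/
theorem exists_diff_eq_single {xs : List S} {q : ℤ} {r : M} :
    (∃ η ∈ chains γ xs.length 1 q, diff xs η = single xs.length r) ↔ InSpan γ q xs r := by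
  induction xs generalizing r with
  | nil =>
    constructor
    · rintro ⟨η, -, h⟩
      exact (congrFun h []).symm
    · rintro rfl
      exact ⟨0, zero_mem _, by rw [single_zero, map_zero]⟩
  | cons x xs ih =>
    constructor
    · rintro ⟨η, hη, h⟩
      obtain ⟨c, hc, hc'⟩ := exists_single (part_true_mem hη)
      refine ⟨c, hc, ih.1 ⟨part false η, part_false_mem hη, ?_⟩⟩
      have h1 := congrArg (part false) h
      rw [diff_cons, part_false_pair, hc', List.length_cons, single, part_false_pair,
        ← single_smul] at h1
      apply add_right_cancel (b := single xs.length (x • c))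
      rw [h1, ← single_add, sub_add_cancel]
    · rintro ⟨c, hc, h⟩
      obtain ⟨η, hη, h'⟩ := ih.2 h
      refine ⟨pair η (single xs.length c), pair_mem hη (single_mem hc), ?_⟩
      rw [diff_cons]
      refine ext_parts rfl ?_ ?_
      · rw [part_false_pair, part_false_pair, part_true_pair, h', ← single_smul, ← single_add,
          sub_add_cancel]
        rfl
      · simp [diff_single, single]

theorem isBoundary_single {xs : List S} {q : ℤ} {r : M} :
    IsBoundary xs γ 0 q (single xs.length r) ↔ InSpan γ (q - 1) xs r := exists_diff_eq_single

theorem vanish_zero_iff {xs : List S} {q : ℤ} :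
    Vanish xs γ 0 q ↔ ∀ r ∈ γ q, InSpan γ (q - 1) xs r := by
  constructor
  · intro h r hr
    exact isBoundary_single.1 (h _ (single_mem hr) (diff_single ..))
  · intro h ω hω _
    obtain ⟨r, hr, rfl⟩ := exists_single hω
    exact isBoundary_single.2 (h r hr)

/-- The kernel of x on the quotient by `xs` is the only obstruction beyond H_1(xs); `hb` says that
it is zero in degree q. -/
theorem vanish_one_cons {x : S} {xs : List S} {q : ℤ} (hx : Raises γ x) (h : Vanish xs γ 1 q)
    (hb : ∀ r ∈ γ q, InSpan γ q xs (x • r) → InSpan γ (q - 1) xs r) :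
    Vanish (x :: xs) γ 1 q := by
  refine vanish_cons hx h ?_
  rw [sub_self]
  rintro ω hω - h0
  obtain ⟨r, hr, rfl⟩ := exists_single hω
  rw [← single_smul] at h0
  exact isBoundary_single.2 (hb r hr (exists_diff_eq_single.1 h0))

end DegreeZero

/-! ### The long exact sequence of a graded surjection -/

section ShortExact

variable {S F M : Type*} [CommRing S] [AddCommGroup M] [Module S M] [AddCommGroup F] [Module S F]
  {α : ℤ → AddSubgroup F} {γ : ℤ → AddSubgroup M}

/-- The grading that the kernel of `f` inherits from `α`. -/
def kerGrading (α : ℤ → AddSubgroup F) (f : F →ₗ[S] M) (q : ℤ) : AddSubgroup F :=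
  α q ⊓ (LinearMap.ker f).toAddSubgroup

theorem mem_chains_kerGrading {f : F →ₗ[S] M} {l : ℕ} {i q : ℤ} {ω : List Bool → F} :
    ω ∈ chains (kerGrading α f) l i q ↔ ω ∈ chains α l i q ∧ f ∘ ω = 0 := by
  constructor
  · intro h
    exact ⟨fun t => ⟨(h t).1.1, (h t).2⟩, funext fun t => (h t).1.2⟩
  · rintro ⟨h, h0⟩ t
    exact ⟨⟨(h t).1, congrFun h0 t⟩, (h t).2⟩

theorem comp_mem_chains {f : F →ₗ[S] M} (hf : ∀ q, ∀ v ∈ α q, f v ∈ γ q) {l : ℕ} {i q : ℤ}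
    {ω : List Bool → F} (h : ω ∈ chains α l i q) : f ∘ ω ∈ chains γ l i q := fun t =>
  ⟨hf q _ (h t).1, fun h0 => (h t).2 fun h1 => h0 (by simp [h1])⟩

theorem exists_lift {f : F →ₗ[S] M} (hf : ∀ q, ∀ m ∈ γ q, ∃ v ∈ α q, f v = m) {l : ℕ} {i q : ℤ}
    {ω : List Bool → M} (h : ω ∈ chains γ l i q) : ∃ η ∈ chains α l i q, f ∘ η = ω := by
  -- Zero values are lifted to zero, so that the lift keeps its support and hence its homological
  -- degree.
  have (t : List Bool) : ∃ v ∈ α q, f v = ω t ∧ (v ≠ 0 → ω t ≠ 0) := by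
    by_cases h0 : ω t = 0
    · exact ⟨0, zero_mem _, by simp [h0], fun h => absurd rfl h⟩
    · obtain ⟨v, hv, hv'⟩ := hf q _ (h t).1
      exact ⟨v, hv, hv', fun _ => h0⟩
  choose η h1 h2 h3 using this
  exact ⟨η, fun t => ⟨h1 t, fun h0 => (h t).2 (h3 t h0)⟩, funext h2⟩

variable {f : F →ₗ[S] M} {xs : List S}

/-- In H_{i+1}(M) → H_i(ker f) → H_i(F), the hypothesis `hb` makes the second map zero. The
connecting map lowers i by one and raises q by one, since the internal degree i + q is preserved. -/
theorem vanish_kerGrading (hx : ∀ x ∈ xs, Raises α x) (hf : ∀ q, ∀ v ∈ α q, f v ∈ γ q)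
    (hs : ∀ q, ∀ m ∈ γ q, ∃ v ∈ α q, f v = m) {i q : ℤ}
    (hb : ∀ ω ∈ chains (kerGrading α f) xs.length i (q + 1), diff xs ω = 0 →
      IsBoundary xs α i (q + 1) ω)
    (h : Vanish xs γ (i + 1) q) : Vanish xs (kerGrading α f) i (q + 1) := by
  intro z hz hz0
  obtain ⟨w, hw, hwz⟩ := hb z hz hz0
  rw [add_sub_cancel_right] at hw
  obtain ⟨v, hv, hvw⟩ := h (f ∘ w) (comp_mem_chains hf hw)
    (by rw [diff_comp, hwz]; exact (mem_chains_kerGrading.1 hz).2)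
  obtain ⟨v', hv', rfl⟩ := exists_lift hs hv
  have hd := diff_mem hx hv'
  rw [add_sub_cancel_right, sub_add_cancel] at hd
  refine ⟨w - diff xs v', ?_, ?_⟩
  · rw [add_sub_cancel_right]
    refine mem_chains_kerGrading.2 ⟨sub_mem hw hd, ?_⟩
    rw [diff_comp] at hvw
    funext t
    have := congrFun hvw t
    simp only [Function.comp_apply] at this
    simp [this]
  · rw [map_sub, diff_diff, hwz, sub_zero]

theorem vanish_of_vanish_kerGrading (hx : ∀ x ∈ xs, Raises α x)
    (hf : ∀ q, ∀ v ∈ α q, f v ∈ γ q) (hs : ∀ q, ∀ m ∈ γ q, ∃ v ∈ α q, f v = m) {i q : ℤ}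
    (hF : Vanish xs α (i + 1) q) (h : Vanish xs (kerGrading α f) i (q + 1)) :
    Vanish xs γ (i + 1) q := by
  intro m hm hm0
  obtain ⟨v, hv, rfl⟩ := exists_lift hs hm
  have hd := diff_mem hx hv
  rw [add_sub_cancel_right] at hd
  rw [diff_comp] at hm0
  obtain ⟨z, hz, hzd⟩ := h (diff xs v) (mem_chains_kerGrading.2 ⟨hd, hm0⟩) (diff_diff ..)
  rw [add_sub_cancel_right] at hz
  obtain ⟨hz1, hz2⟩ := mem_chains_kerGrading.1 hz
  obtain ⟨g, hg, hgd⟩ := hF (v - z) (sub_mem hv hz1) (by rw [map_sub, hzd, sub_self])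
  refine ⟨f ∘ g, comp_mem_chains hf hg, ?_⟩
  rw [diff_comp, hgd]
  funext t
  have := congrFun hz2 t
  simp only [Function.comp_apply, Pi.zero_apply] at this
  simp [this]

/-- By right exactness of H_0(ker f) → H_0(F) → H_0(M) → 0, whose first map is zero by `hb`. -/
theorem vanish_zero_congr (hx : ∀ x ∈ xs, Raises α x)
    (hf : ∀ q, ∀ v ∈ α q, f v ∈ γ q) (hs : ∀ q, ∀ m ∈ γ q, ∃ v ∈ α q, f v = m) {q : ℤ}
    (hb : ∀ ω ∈ chains (kerGrading α f) xs.length 0 q, diff xs ω = 0 → IsBoundary xs α 0 q ω) :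
    Vanish xs γ 0 q ↔ Vanish xs α 0 q := by
  constructor
  · intro h w hw hw0
    obtain ⟨v, hv, hvw⟩ := h (f ∘ w) (comp_mem_chains hf hw)
      (by rw [diff_comp, hw0]; funext t; simp)
    obtain ⟨v', hv', rfl⟩ := exists_lift hs hv
    have hd := diff_mem hx hv'
    rw [add_sub_cancel_right, sub_add_cancel] at hd
    rw [diff_comp] at hvw
    obtain ⟨u, hu, hud⟩ := hb (w - diff xs v')
      (mem_chains_kerGrading.2 ⟨sub_mem hw hd, funext fun t => by
        have := congrFun hvw t
        simp only [Function.comp_apply] at this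
        simp [this]⟩) (by rw [map_sub, diff_diff, hw0, sub_zero])
    exact ⟨u + v', add_mem hu hv', by rw [map_add, hud, sub_add_cancel]⟩
  · intro h m hm hm0
    obtain ⟨w, hw, rfl⟩ := exists_lift hs hm
    obtain ⟨r, -, rfl⟩ := exists_single hw
    obtain ⟨g, hg, hgd⟩ := h _ hw (diff_single ..)
    exact ⟨f ∘ g, comp_mem_chains hf hg, by rw [diff_comp, hgd]⟩

end ShortExact

end Koszul

namespace Koszul

/-! ### Finite powers with shifted gradings -/

section Pi

variable {S M ι : Type*} [CommRing S] [AddCommGroup M] [Module S M]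

/-- The grading of a finite power of `M` for which a vector is homogeneous when its coordinates
are homogeneous for given gradings. -/
def piGrading (γ : ι → ℤ → AddSubgroup M) (q : ℤ) : AddSubgroup (ι → M) where
  carrier := {v | ∀ j, v j ∈ γ j q}
  zero_mem' := fun _ => zero_mem _
  add_mem' := fun hv hw j => add_mem (hv j) (hw j)
  neg_mem' := fun hv j => neg_mem (hv j)

variable {γ : ι → ℤ → AddSubgroup M}

theorem vanish_piGrading {xs : List S} {i q : ℤ} (h : ∀ j, Vanish xs (γ j) i q) :
    Vanish xs (piGrading γ) i q := by
  intro ω hω h0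
  have (j : ι) : IsBoundary xs (γ j) i q ((LinearMap.proj j : (ι → M) →ₗ[S] M) ∘ ω) := by
    apply h
    · exact fun t => ⟨(hω t).1 j, fun h1 => (hω t).2 fun h2 => h1 (by simp [h2])⟩
    · rw [diff_comp, h0]; rfl
  choose η hη hd using this
  let η' : List Bool → ι → M := fun t j => η j t
  have hp (j : ι) : (LinearMap.proj j : (ι → M) →ₗ[S] M) ∘ η' = η j := rfl
  refine ⟨η', fun t => ⟨fun j => (hη j t).1, fun h1 => ?_⟩, ?_⟩
  · obtain ⟨j, hj⟩ := Function.ne_iff.1 h1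
    exact (hη j t).2 hj
  · funext t j
    have := congrFun (hd j) t
    rw [← hp, diff_comp] at this
    exact this

theorem inSpan_piGrading {xs : List S} {q : ℤ} {v : ι → M} :
    InSpan (piGrading γ) q xs v ↔ ∀ j, InSpan (γ j) q xs (v j) := by
  induction xs generalizing v with
  | nil => exact funext_iff
  | cons x xs ih =>
    constructor
    · rintro ⟨c, hc, h⟩ j
      exact ⟨c j, hc j, ih.1 h j⟩
    · intro h
      choose c hc h using h
      exact ⟨c, hc, ih.2 h⟩

end Pi

/-! ### Koszul homology of polynomial rings and graded free modules -/

section Polynomial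

open MvPolynomial

variable {σ k : Type*} [CommRing k]

/-- The grading of the polynomial ring by degree, indexed by the integers. -/
def polyGrading (σ k : Type*) [CommRing k] (q : ℤ) : AddSubgroup (MvPolynomial σ k) where
  carrier := {f | ∀ m, coeff m f ≠ 0 → (m.degree : ℤ) = q}
  zero_mem' := fun m h => absurd (coeff_zero m) h
  add_mem' := fun {f g} hf hg m h => by
    by_cases h0 : coeff m f = 0
    · exact hg m fun h1 => h (by simp [h0, h1])
    · exact hf m h0
  neg_mem' := fun {f} hf m h => hf m fun h0 => h (by simp [h0])

theorem mem_polyGrading {q : ℤ} {f : MvPolynomial σ k} :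
    f ∈ polyGrading σ k q ↔ ∀ m, coeff m f ≠ 0 → (m.degree : ℤ) = q := Iff.rfl

theorem mem_polyGrading_natCast {n : ℕ} {f : MvPolynomial σ k} :
    f ∈ polyGrading σ k n ↔ f.IsHomogeneous n := by
  rw [mem_polyGrading, IsHomogeneous, IsWeightedHomogeneous]
  simp only [Nat.cast_inj]
  constructor
  · intro h m hm
    rw [← h m hm, Finsupp.degree_eq_weight_one]
    rfl
  · intro h m hm
    rw [← h hm, Finsupp.degree_eq_weight_one]
    rfl

theorem eq_zero_of_mem_polyGrading_of_neg {q : ℤ} (hq : q < 0) {f : MvPolynomial σ k}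
    (hf : f ∈ polyGrading σ k q) : f = 0 := by
  ext m
  by_contra h
  have := hf m (by simpa using h)
  omega

theorem mul_mem_polyGrading {p q : ℤ} {f g : MvPolynomial σ k} (hf : f ∈ polyGrading σ k p)
    (hg : g ∈ polyGrading σ k q) : f * g ∈ polyGrading σ k (p + q) := by
  rcases lt_or_ge p 0 with hp | hp
  · rw [eq_zero_of_mem_polyGrading_of_neg hp hf, zero_mul]; exact zero_mem _
  rcases lt_or_ge q 0 with hq | hq
  · rw [eq_zero_of_mem_polyGrading_of_neg hq hg, mul_zero]; exact zero_mem _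
  lift p to ℕ using hp
  lift q to ℕ using hq
  rw [mem_polyGrading_natCast] at hf hg
  exact_mod_cast mem_polyGrading_natCast.2 (hf.mul hg)

theorem X_mem_polyGrading (s : σ) : (X s : MvPolynomial σ k) ∈ polyGrading σ k 1 := by
  exact_mod_cast mem_polyGrading_natCast.2 (isHomogeneous_X k s)

theorem raises_X (s : σ) : Raises (polyGrading σ k) (X s : MvPolynomial σ k) := by
  intro q f hf
  rw [smul_eq_mul, add_comm]
  exact mul_mem_polyGrading (X_mem_polyGrading s) hf

theorem divMonomial_mem_polyGrading {q : ℤ} {f : MvPolynomial σ k}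
    (hf : f ∈ polyGrading σ k (q + 1)) (s : σ) :
    f.divMonomial (Finsupp.single s 1) ∈ polyGrading σ k q := by
  intro m hm
  rw [coeff_divMonomial] at hm
  have := hf _ hm
  simp only [map_add, Finsupp.degree_single] at this
  push_cast at this
  omega

/-- The variables with indices in a list. -/
noncomputable abbrev varList (k : Type*) [CommRing k] {σ : Type*} (l : List σ) :
    List (MvPolynomial σ k) := l.map X

/-- Division by `X s` leaves a remainder made of the monomials of f free of `X s`, and the criterion
for the rest of the list applies to it. -/
theorem inSpan_X_iff {l : List σ} {q : ℤ} {f : MvPolynomial σ k}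
    (hf : f ∈ polyGrading σ k (q + 1)) :
    InSpan (polyGrading σ k) q (varList k l) f ↔ ∀ m, coeff m f ≠ 0 → ∃ s ∈ l, m s ≠ 0 := by
  classical
  induction l generalizing f with
  | nil =>
    simp only [List.map_nil, InSpan, List.not_mem_nil, false_and, exists_false, imp_false,
      not_not]
    exact ⟨fun h m => by simp [h], fun h => by ext m; simpa using h m⟩
  | cons s l ih =>
    constructor
    · rintro ⟨c, hc, h⟩ m hm
      by_cases h0 : m s = 0
      · obtain ⟨t, ht, h1⟩ := (ih (sub_mem hf (raises_X (k := k) s q c hc))).1 h m (by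
          rw [smul_eq_mul, coeff_sub, coeff_X_mul', if_neg (by simpa using h0), sub_zero]
          exact hm)
        exact ⟨t, List.mem_cons_of_mem _ ht, h1⟩
      · exact ⟨s, List.mem_cons_self, h0⟩
    · intro h
      have hc := divMonomial_mem_polyGrading hf s
      refine ⟨_, hc, (ih (sub_mem hf (raises_X (k := k) s q _ hc))).2 fun m hm => ?_⟩
      have he : f - (X s : MvPolynomial σ k) • f.divMonomial (Finsupp.single s 1) =
          f.modMonomial (Finsupp.single s 1) := by
        rw [smul_eq_mul, sub_eq_iff_eq_add', divMonomial_add_modMonomial_single]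
      rw [he] at hm
      have h0 : m s = 0 := by
        by_contra h0
        refine hm (coeff_modMonomial_of_le _ ?_)
        rw [Finsupp.single_le_iff]
        omega
      rw [coeff_modMonomial_of_not_le _ (by rw [Finsupp.single_le_iff]; omega)] at hm
      obtain ⟨t, ht, h1⟩ := h m hm
      rcases List.mem_cons.1 ht with rfl | ht
      · exact absurd h0 h1
      · exact ⟨t, ht, h1⟩

/-- Distinct variables form a regular sequence. Only H_1 uses this; above it, the two neighbouring
homologies of the shorter list already vanish. -/
theorem vanish_X {l : List σ} (hl : l.Nodup) {i q : ℤ} (hi : 1 ≤ i) :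
    Vanish (varList k l) (polyGrading σ k) i q := by
  classical
  induction l generalizing i with
  | nil => exact vanish_of_length_lt (by simp only [List.map_nil, List.length_nil]; omega)
  | cons s l ih =>
    rw [List.nodup_cons] at hl
    rcases hi.eq_or_lt with rfl | hi
    · refine vanish_one_cons (raises_X s) (ih hl.2 le_rfl) fun f hf h => ?_
      rw [inSpan_X_iff (by simpa using hf)]
      rw [inSpan_X_iff (raises_X s q f hf)] at h
      intro m hm
      obtain ⟨t, ht, h1⟩ := h (Finsupp.single s 1 + m) (by rwa [smul_eq_mul, coeff_X_mul])
      refine ⟨t, ht, ?_⟩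
      have hst : s ≠ t := fun h => hl.1 (h ▸ ht)
      simpa [Finsupp.single_apply, hst] using h1
    · exact vanish_cons_of_vanish (raises_X s) (ih hl.2 (by omega)) (ih hl.2 (by omega))

variable {ι : Type*}

/-- The grading of the free module with a basis of the given degrees. -/
noncomputable def freeGrading (k : Type*) [CommRing k] (σ : Type*) {ι : Type*} (deg : ι → ℕ) :
    ℤ → AddSubgroup (ι → MvPolynomial σ k) :=
  piGrading fun j q => polyGrading σ k (q - deg j)

variable {deg : ι → ℕ}

theorem raises_X_free (s : σ) : Raises (freeGrading k σ deg) (X s : MvPolynomial σ k) := by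
  intro q v hv j
  have := raises_X s _ _ (hv j)
  rwa [sub_add_eq_add_sub] at this

theorem Vanish.shift {S M : Type*} [CommRing S] [AddCommGroup M] [Module S M] {xs : List S}
    {γ : ℤ → AddSubgroup M} {i q n : ℤ} (h : Vanish xs γ i (q - n)) :
    Vanish xs (fun p => γ (p - n)) i q := by
  intro ω hω h0
  obtain ⟨η, hη, hd⟩ := h ω hω h0
  rw [sub_right_comm] at hη
  exact ⟨η, hη, hd⟩

theorem inSpan_shift {S M : Type*} [CommRing S] [AddCommGroup M] [Module S M] {xs : List S}
    {γ : ℤ → AddSubgroup M} {q n : ℤ} {r : M} :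
    InSpan (fun p => γ (p - n)) q xs r ↔ InSpan γ (q - n) xs r := by
  induction xs generalizing r with
  | nil => rfl
  | cons x xs ih => simp only [InSpan, ih]

theorem vanish_X_free {l : List σ} (hl : l.Nodup) {i q : ℤ} (hi : 1 ≤ i) :
    Vanish (varList k l) (freeGrading k σ deg) i q :=
  vanish_piGrading fun _ => (vanish_X hl hi).shift

theorem inSpan_X_free {l : List σ} (hl : ∀ s, s ∈ l) {q : ℤ} {v : ι → MvPolynomial σ k}
    (hv : v ∈ freeGrading k σ deg q) :
    InSpan (freeGrading k σ deg) (q - 1) (varList k l) v ↔ ∀ j, constantCoeff (v j) = 0 := by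
  rw [freeGrading, inSpan_piGrading]
  refine forall_congr' fun j => ?_
  have h := hv j
  rw [inSpan_shift, inSpan_X_iff (by rwa [sub_right_comm, sub_add_cancel])]
  constructor
  · intro h0
    by_contra h1
    obtain ⟨s, -, h2⟩ := h0 0 h1
    exact h2 rfl
  · intro h0 m hm
    have : m ≠ 0 := by rintro rfl; exact hm h0
    obtain ⟨s, hs⟩ := Finsupp.ne_iff.1 this
    exact ⟨s, hl s, hs⟩

/-- Over all the variables, the Koszul homology of a free module in homological degree zero has
the degrees of the basis. -/
theorem vanish_X_free_zero [Nontrivial k] {l : List σ} (hl : ∀ s, s ∈ l) {q : ℤ} :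
    Vanish (varList k l) (freeGrading k σ deg) 0 q ↔ ∀ j, (deg j : ℤ) ≠ q := by
  classical
  rw [vanish_zero_iff]
  constructor
  · rintro h j rfl
    have h1 : (Pi.single j 1 : ι → MvPolynomial σ k) ∈ freeGrading k σ deg (deg j) := by
      intro i
      by_cases hij : i = j
      · subst hij
        rw [Pi.single_eq_same]
        show (1 : MvPolynomial σ k) ∈ polyGrading σ k ((deg i : ℤ) - deg i)
        rw [sub_self]
        exact_mod_cast mem_polyGrading_natCast.2 (isHomogeneous_one σ k)
      · rw [Pi.single_eq_of_ne hij]; exact zero_mem _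
    have := (inSpan_X_free hl h1).1 (h _ h1) j
    simp at this
  · intro h v hv
    rw [inSpan_X_free hl hv]
    intro j
    by_contra h0
    have := hv j 0 h0
    simp only [map_zero, Nat.cast_zero] at this
    exact h j (by omega)

/-- Cycles with entries in the ideal of the variables are boundaries, in every homological
degree. -/
theorem isBoundary_of_constantCoeff {l : List σ} (hl : l.Nodup) (hl' : ∀ s, s ∈ l) {i q : ℤ}
    {ω : List Bool → ι → MvPolynomial σ k}
    (hω : ω ∈ chains (freeGrading k σ deg) (varList k l).length i q)
    (h0 : diff (varList k l) ω = 0) (hc : ∀ t j, constantCoeff (ω t j) = 0) :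
    IsBoundary (varList k l) (freeGrading k σ deg) i q ω := by
  rcases lt_trichotomy i 0 with hi | rfl | hi
  · exact vanish_of_neg hi ω hω h0
  · obtain ⟨r, hr, rfl⟩ := exists_single hω
    rw [isBoundary_single, inSpan_X_free hl' hr]
    intro j
    -- The value of a chain of homological degree zero is read off at the all-`false` list.
    have h1 : single (varList k l).length r
        (List.replicate (varList k l).length false) = r := by
      generalize (varList k l).length = n
      induction n with
      | zero => rfl
      | succ n ih => exact ih
    rw [← h1]
    exact hc _ j
  · exact vanish_X_free hl hi ω hω h0

end Polynomial

end Koszul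

namespace Koszul

open MvPolynomial

/-! ### Minimal graded covers by free modules -/

section Cover

variable {σ k ι M : Type*} [Field k] [AddCommGroup M] [Module (MvPolynomial σ k) M]
  {deg : ι → ℕ} {γ : ℤ → AddSubgroup M}

theorem iSup_freeGrading [Finite ι] : ⨆ q, freeGrading k σ deg q = ⊤ := by
  classical
  cases nonempty_fintype ι
  refine eq_top_iff.2 fun v _ => ?_
  rw [← Finset.univ_sum_single v]
  refine sum_mem fun j _ => ?_
  suffices h : ∀ f : MvPolynomial σ k, Pi.single j f ∈ ⨆ q, freeGrading k σ deg q from h _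
  intro f
  induction f using MvPolynomial.induction_on' with
  | monomial m c =>
    refine (le_iSup (freeGrading k σ deg) (m.degree + deg j)) fun i => ?_
    by_cases hij : i = j
    · subst hij
      rw [Pi.single_eq_same]
      intro m' hm'
      rw [coeff_monomial] at hm'
      split_ifs at hm' with h
      · subst h; simp
      · exact absurd rfl hm'
    · rw [Pi.single_eq_of_ne hij]; exact zero_mem _
  | add f g hf hg => rw [Pi.single_add]; exact add_mem hf hg

theorem iSupIndep_freeGrading : iSupIndep (freeGrading k σ deg) := by
  intro q
  rw [disjoint_iff_inf_le]
  rintro v ⟨hv, hv'⟩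
  -- `T` consists of the vectors without terms of degree q: it contains all other components and
  -- meets the q-th one in zero.
  let T : AddSubgroup (ι → MvPolynomial σ k) :=
    { carrier := {w | ∀ j m, (m.degree : ℤ) = q - deg j → coeff m (w j) = 0}
      zero_mem' := fun j m _ => coeff_zero m
      add_mem' := fun {v w} hv hw j m h => by simp [hv j m h, hw j m h]
      neg_mem' := fun {v} hv j m h => by simp [hv j m h] }
  have hT : ⨆ p, ⨆ (_ : p ≠ q), freeGrading k σ deg p ≤ T := by
    refine iSup₂_le fun p hp w hw j m hm => ?_
    by_contra h0
    exact hp (by have := hw j m h0; omega)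
  refine AddSubgroup.mem_bot.2 (funext fun j => ?_)
  ext m
  by_contra h0
  exact h0 (hT hv' j m (hv j m h0))

/-- A homogeneous element in the range of a graded map from a free module is the image of a
homogeneous vector. -/
theorem exists_homogeneous_lift [Finite ι] (f : (ι → MvPolynomial σ k) →ₗ[MvPolynomial σ k] M)
    (hf : ∀ q, ∀ v ∈ freeGrading k σ deg q, f v ∈ γ q) (hγ : iSupIndep γ) {q : ℤ} {m : M}
    (hm : m ∈ γ q) (h : m ∈ LinearMap.range f) : ∃ v ∈ freeGrading k σ deg q, f v = m := by
  obtain ⟨w, rfl⟩ := h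
  have hw : w ∈ freeGrading k σ deg q ⊔ ⨆ p, ⨆ (_ : p ≠ q), freeGrading k σ deg p := by
    rw [← iSup_split_single, iSup_freeGrading]
    exact AddSubgroup.mem_top w
  obtain ⟨v, hv, u, hu, rfl⟩ := AddSubgroup.mem_sup.1 hw
  have hu' : ⨆ p, ⨆ (_ : p ≠ q), freeGrading k σ deg p ≤
      (⨆ p, ⨆ (_ : p ≠ q), γ p).comap f.toAddMonoidHom :=
    iSup₂_le fun p hp w hw => (le_iSup₂ (f := fun p (_ : p ≠ q) => γ p) p hp) (hf p w hw)
  -- The discarded part u maps into the other components, yet f u = m - f v has degree q;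
  -- independence gives f u = 0.
  refine ⟨v, hv, ?_⟩
  have h0 : f u ∈ γ q := by
    have := sub_mem hm (hf q v hv)
    rwa [map_add, add_sub_cancel_left] at this
  have := (hγ q).le_bot ⟨h0, hu' hu⟩
  rw [AddSubgroup.mem_bot] at this
  rw [map_add, this, add_zero]

variable {f : (ι → MvPolynomial σ k) →ₗ[MvPolynomial σ k] M} {l : List σ}

theorem raises_varList (l : List σ) : ∀ x ∈ varList k l, Raises (freeGrading k σ deg) x := by
  intro x hx
  obtain ⟨s, -, rfl⟩ := List.mem_map.1 hx
  exact raises_X_free s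

/-- A minimal graded cover by a free module shifts Koszul homology. -/
theorem vanish_succ_iff (hl : l.Nodup) (hl' : ∀ s, s ∈ l)
    (hf : ∀ q, ∀ v ∈ freeGrading k σ deg q, f v ∈ γ q)
    (hs : ∀ q, ∀ m ∈ γ q, ∃ v ∈ freeGrading k σ deg q, f v = m)
    (hker : ∀ v, f v = 0 → ∀ j, constantCoeff (v j) = 0) {i q : ℤ} (hi : 0 ≤ i) :
    Vanish (varList k l) γ (i + 1) q ↔
      Vanish (varList k l) (kerGrading (freeGrading k σ deg) f) i (q + 1) :=
  ⟨vanish_kerGrading (raises_varList l) hf hs fun _ hω h0 =>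
      isBoundary_of_constantCoeff hl hl' (mem_chains_kerGrading.1 hω).1 h0
        fun t => hker _ (hω t).1.2,
    vanish_of_vanish_kerGrading (raises_varList l) hf hs (vanish_X_free hl (by omega))⟩

/-- By minimality the cover induces an isomorphism on H_0, and H_0 of a free module sits in the
degrees of its basis. -/
theorem vanish_zero_iff_degree_ne (hl : l.Nodup) (hl' : ∀ s, s ∈ l)
    (hf : ∀ q, ∀ v ∈ freeGrading k σ deg q, f v ∈ γ q)
    (hs : ∀ q, ∀ m ∈ γ q, ∃ v ∈ freeGrading k σ deg q, f v = m)
    (hker : ∀ v, f v = 0 → ∀ j, constantCoeff (v j) = 0) {q : ℤ} :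
    Vanish (varList k l) γ 0 q ↔ ∀ j, (deg j : ℤ) ≠ q := by
  rw [← vanish_X_free_zero (k := k) hl']
  exact vanish_zero_congr (raises_varList l) hf hs fun _ hω h0 =>
      isBoundary_of_constantCoeff hl hl' (mem_chains_kerGrading.1 hω).1 h0
        fun t => hker _ (hω t).1.2

end Cover

/-! ### Betti degrees as degrees of Koszul homology -/

section Resolution

variable {σ k M : Type*} [Field k] [AddCommGroup M] [Module (MvPolynomial σ k) M]

/-- A minimal graded free resolution, possibly infinite, of a module graded by `γ`. -/
structure Resolution (k σ : Type*) [Field k] {M : Type*} [AddCommGroup M]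
    [Module (MvPolynomial σ k) M] (γ : ℤ → AddSubgroup M) where
  rank : ℕ → ℕ
  degree : (i : ℕ) → Fin (rank i) → ℕ
  aug : (Fin (rank 0) → MvPolynomial σ k) →ₗ[MvPolynomial σ k] M
  D : (i : ℕ) → Matrix (Fin (rank i)) (Fin (rank (i + 1))) (MvPolynomial σ k)
  aug_mem : ∀ q, ∀ v ∈ freeGrading k σ (degree 0) q, aug v ∈ γ q
  D_mem : ∀ i j l, D i j l ∈ polyGrading σ k ((degree (i + 1) l : ℤ) - degree i j)
  surjective : Function.Surjective aug
  exact_zero : Function.Exact (D 0).mulVecLin aug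
  exact_succ : ∀ i, Function.Exact (D (i + 1)).mulVecLin (D i).mulVecLin
  minimal : ∀ i j l, constantCoeff (D i j l) = 0

theorem mulVec_mem_freeGrading {m n : ℕ} {deg : Fin m → ℕ} {deg' : Fin n → ℕ}
    {D : Matrix (Fin m) (Fin n) (MvPolynomial σ k)}
    (hD : ∀ j l, D j l ∈ polyGrading σ k ((deg' l : ℤ) - deg j)) (q : ℤ)
    (v : Fin n → MvPolynomial σ k) (hv : v ∈ freeGrading k σ deg' q) :
    D.mulVecLin v ∈ freeGrading k σ deg q := by
  intro j
  rw [Matrix.mulVecLin_apply, Matrix.mulVec, dotProduct]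
  refine sum_mem fun l _ => ?_
  have := mul_mem_polyGrading (hD j l) (hv l)
  rwa [show (deg' l : ℤ) - deg j + (q - deg' l) = q - deg j by ring] at this

theorem constantCoeff_mulVec {m n : ℕ} {D : Matrix (Fin m) (Fin n) (MvPolynomial σ k)}
    (hD : ∀ j l, constantCoeff (D j l) = 0) (v : Fin n → MvPolynomial σ k) (j : Fin m) :
    constantCoeff (D.mulVecLin v j) = 0 := by
  rw [Matrix.mulVecLin_apply, Matrix.mulVec, dotProduct, map_sum]
  exact Finset.sum_eq_zero fun l _ => by rw [map_mul, hD, zero_mul]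

namespace Resolution

variable {γ : ℤ → AddSubgroup M} (F : Resolution k σ γ)

/-- The grading of the kernel of the map that leaves the `i`-th free module. -/
noncomputable def syzygy : (i : ℕ) → ℤ → AddSubgroup (Fin (F.rank i) → MvPolynomial σ k)
  | 0 => kerGrading (freeGrading k σ (F.degree 0)) F.aug
  | i + 1 => kerGrading (freeGrading k σ (F.degree (i + 1))) (F.D i).mulVecLin

theorem mem_syzygy {i : ℕ} {q : ℤ} {v : Fin (F.rank i) → MvPolynomial σ k} :
    v ∈ F.syzygy i q ↔
      v ∈ freeGrading k σ (F.degree i) q ∧ v ∈ LinearMap.range (F.D i).mulVecLin := by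
  cases i with
  | zero => exact and_congr_right fun _ => F.exact_zero v
  | succ i => exact and_congr_right fun _ => F.exact_succ i v

theorem D_mem_syzygy (i : ℕ) (q : ℤ) (v : Fin (F.rank (i + 1)) → MvPolynomial σ k)
    (hv : v ∈ freeGrading k σ (F.degree (i + 1)) q) :
    (F.D i).mulVecLin v ∈ F.syzygy i q :=
  F.mem_syzygy.2 ⟨mulVec_mem_freeGrading (F.D_mem i) q v hv, v, rfl⟩

theorem exists_D_eq (i : ℕ) (q : ℤ) (m : Fin (F.rank i) → MvPolynomial σ k)
    (hm : m ∈ F.syzygy i q) :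
    ∃ v ∈ freeGrading k σ (F.degree (i + 1)) q, (F.D i).mulVecLin v = m :=
  exists_homogeneous_lift _ (mulVec_mem_freeGrading (F.D_mem i)) iSupIndep_freeGrading
    (F.mem_syzygy.1 hm).1 (F.mem_syzygy.1 hm).2

theorem constantCoeff_eq_zero (i : ℕ) (v : Fin (F.rank (i + 1)) → MvPolynomial σ k)
    (hv : (F.D i).mulVecLin v = 0) (j) : constantCoeff (v j) = 0 := by
  obtain ⟨w, rfl⟩ := (F.exact_succ i v).1 hv
  exact constantCoeff_mulVec (F.minimal (i + 1)) w j

theorem constantCoeff_eq_zero_of_aug (v : Fin (F.rank 0) → MvPolynomial σ k)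
    (hv : F.aug v = 0) (j) : constantCoeff (v j) = 0 := by
  obtain ⟨w, rfl⟩ := (F.exact_zero v).1 hv
  exact constantCoeff_mulVec (F.minimal 0) w j

variable {l : List σ}

/-- Dimension shifting: each step trades one homological degree for the next syzygy module, until
H_0 is reached. A separate `N` avoids transport between `Fin (F.rank _)` for equal indices. -/
theorem vanish_syzygy_iff (hl : l.Nodup) (hl' : ∀ s, s ∈ l) (i n N : ℕ) (hN : N = n + i + 1)
    (q : ℤ) :
    Vanish (varList k l) (F.syzygy n) i q ↔ ∀ j, (F.degree N j : ℤ) ≠ q + i := by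
  induction i generalizing n q with
  | zero =>
    subst hN
    simp only [Nat.cast_zero, add_zero]
    exact vanish_zero_iff_degree_ne hl hl' (F.D_mem_syzygy n) (F.exists_D_eq n)
      (F.constantCoeff_eq_zero n)
  | succ i ih =>
    rw [Nat.cast_succ, vanish_succ_iff hl hl' (F.D_mem_syzygy n) (F.exists_D_eq n)
      (F.constantCoeff_eq_zero n) (Int.natCast_nonneg i), add_comm (i : ℤ), ← add_assoc]
    exact ih (n + 1) (by omega) (q + 1)

/-- The degrees of the basis of the `i`-th module of a minimal resolution are those in which the
`i`-th Koszul homology is nonzero. -/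
theorem vanish_iff (hγ : iSupIndep γ) (hl : l.Nodup) (hl' : ∀ s, s ∈ l) (i : ℕ) (q : ℤ) :
    Vanish (varList k l) γ i q ↔ ∀ j, (F.degree i j : ℤ) ≠ q + i := by
  have hs : ∀ q, ∀ m ∈ γ q, ∃ v ∈ freeGrading k σ (F.degree 0) q, F.aug v = m := fun q m hm =>
    exists_homogeneous_lift F.aug F.aug_mem hγ hm (F.surjective m)
  cases i with
  | zero =>
    simp only [Nat.cast_zero, add_zero]
    exact vanish_zero_iff_degree_ne hl hl' F.aug_mem hs F.constantCoeff_eq_zero_of_aug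
  | succ i =>
    rw [Nat.cast_succ, vanish_succ_iff hl hl' F.aug_mem hs F.constantCoeff_eq_zero_of_aug
      (Int.natCast_nonneg i), add_comm (i : ℤ), ← add_assoc]
    exact F.vanish_syzygy_iff hl hl' i 0 _ (by omega) (q + 1)

/-- A minimal resolution over a polynomial ring in finitely many variables is finite. -/
theorem rank_eq_zero (hγ : iSupIndep γ) (hl : l.Nodup) (hl' : ∀ s, s ∈ l) {i : ℕ}
    (hi : l.length < i) : F.rank i = 0 := by
  by_contra h
  obtain ⟨n, hn⟩ := Nat.exists_eq_succ_of_ne_zero h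
  let j : Fin (F.rank i) := ⟨0, by omega⟩
  -- A basis vector of F_i would give nonzero Koszul homology in a degree above the number of
  -- variables.
  refine (F.vanish_iff hγ hl hl' i ((F.degree i j : ℤ) - i)).1 (vanish_of_length_lt ?_) j
    (by ring)
  rw [List.length_map]
  exact_mod_cast hi

theorem isGreatest (hγ : iSupIndep γ) (hl : l.Nodup) (hl' : ∀ s, s ∈ l) {m : ℤ}
    (h : ∀ i q, m < q → Vanish (varList k l) γ i q) (h' : ∃ i, ¬ Vanish (varList k l) γ i m) :
    IsGreatest {z : ℤ | ∃ (i : ℕ) (j : Fin (F.rank i)), z = (F.degree i j : ℤ) - i} m := by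
  constructor
  · obtain ⟨i, hi⟩ := h'
    have hi0 : 0 ≤ i := by
      by_contra h0
      exact hi (vanish_of_neg (not_le.1 h0))
    lift i to ℕ using hi0
    rw [F.vanish_iff hγ hl hl'] at hi
    push Not at hi
    obtain ⟨j, hj⟩ := hi
    exact ⟨i, j, by rw [hj]; ring⟩
  · rintro z ⟨i, j, rfl⟩
    by_contra h0
    exact (F.vanish_iff hγ hl hl' i _).1 (h i _ (not_le.1 h0)) j (by ring)

end Resolution

end Resolution

end Koszul

/-! ### Existence of minimal graded resolutions -/

namespace Koszul

open MvPolynomial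

theorem exists_finsupp_of_mem_iSup {F : Type*} [AddCommGroup F] {α : ℤ → AddSubgroup F} {v : F}
    (hv : v ∈ ⨆ q, α q) : ∃ g : ℤ →₀ F, (∀ p, g p ∈ α p) ∧ ∑ p ∈ g.support, g p = v := by
  classical
  induction hv using AddSubgroup.iSup_induction' with
  | hp i x hx =>
    refine ⟨Finsupp.single i x, fun p => ?_, Finsupp.sum_single_index (h := fun _ x => x) rfl⟩
    rw [Finsupp.single_apply]
    split_ifs with h
    · exact h ▸ hx
    · exact zero_mem _
  | h1 => exact ⟨0, fun _ => zero_mem _, rfl⟩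
  | hadd x y _ _ hx hy =>
    obtain ⟨g, hg, rfl⟩ := hx
    obtain ⟨h, hh, rfl⟩ := hy
    exact ⟨g + h, fun p => add_mem (hg p) (hh p),
      Finsupp.sum_add_index' (h := fun _ x => x) (fun _ => rfl) fun _ _ _ => rfl⟩

theorem eq_zero_of_sum_eq_zero {M : Type*} [AddCommGroup M] {γ : ℤ → AddSubgroup M}
    (hγ : iSupIndep γ) {s : Finset ℤ} {g : ℤ → M} (hg : ∀ p, g p ∈ γ p)
    (h : ∑ p ∈ s, g p = 0) {q : ℤ} (hq : q ∈ s) : g q = 0 := by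
  classical
  rw [← Finset.add_sum_erase s g hq] at h
  have h1 : ∑ p ∈ s.erase q, g p ∈ ⨆ p, ⨆ (_ : p ≠ q), γ p := sum_mem fun p hp =>
    (le_iSup₂ (f := fun p (_ : p ≠ q) => γ p) p (Finset.ne_of_mem_erase hp)) (hg p)
  rw [add_eq_zero_iff_eq_neg] at h
  have h2 : g q ∈ ⨆ p, ⨆ (_ : p ≠ q), γ p := by rw [h]; exact neg_mem h1
  have := (hγ q).le_bot ⟨hg q, h2⟩
  exact AddSubgroup.mem_bot.1 this

section

variable {σ k ι M : Type*} [Field k] [AddCommGroup M] [Module (MvPolynomial σ k) M]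
  {deg : ι → ℕ} {γ : ℤ → AddSubgroup M}

/-- The images of the homogeneous components of v lie in independent pieces and sum to zero, so each
component is in the kernel. -/
theorem ker_le_iSup [Finite ι] (f : (ι → MvPolynomial σ k) →ₗ[MvPolynomial σ k] M)
    (hf : ∀ q, ∀ v ∈ freeGrading k σ deg q, f v ∈ γ q) (hγ : iSupIndep γ)
    {v : ι → MvPolynomial σ k} (hv : f v = 0) :
    v ∈ ⨆ q, kerGrading (freeGrading k σ deg) f q := by
  have h : v ∈ ⨆ q, freeGrading k σ deg q := by
    rw [iSup_freeGrading]
    exact AddSubgroup.mem_top v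
  obtain ⟨g, hg, rfl⟩ := exists_finsupp_of_mem_iSup h
  rw [map_sum] at hv
  exact sum_mem fun p hp => (le_iSup (kerGrading (freeGrading k σ deg) f) p)
    ⟨hg p, eq_zero_of_sum_eq_zero hγ (fun p => hf p _ (hg p)) hv hp⟩

end

section Step

variable (k σ : Type*) [Field k]

/-- A graded submodule of the maximal multiple of a graded free module. -/
structure Stage where
  rank : ℕ
  degree : Fin rank → ℕ
  Z : Submodule (MvPolynomial σ k) (Fin rank → MvPolynomial σ k)
  homogeneous : ∀ v ∈ Z, v ∈ ⨆ q, freeGrading k σ degree q ⊓ Z.toAddSubgroup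
  constantCoeff_eq_zero : ∀ v ∈ Z, ∀ j, constantCoeff (v j) = 0

variable {k σ}

/-- `z` is a family of homogeneous generators of degrees `deg` of the submodule of a stage. -/
def Stage.Generates (A : Stage k σ) {n : ℕ} (deg : Fin n → ℕ)
    (z : Fin n → (Fin A.rank → MvPolynomial σ k)) : Prop :=
  (∀ l, z l ∈ freeGrading k σ A.degree (deg l)) ∧
    Submodule.span (MvPolynomial σ k) (Set.range z) = A.Z

/-- The homogeneous elements span, and by noetherianity finitely many of them suffice. Natural
degrees are enough because homogeneous vectors of negative degree are zero. -/
theorem Stage.exists_generates [Finite σ] (A : Stage k σ) :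
    ∃ n, ∃ (deg : Fin n → ℕ) (z : _), A.Generates deg z := by
  let H : Set (Fin A.rank → MvPolynomial σ k) :=
    {v | v ∈ A.Z ∧ ∃ q : ℕ, v ∈ freeGrading k σ A.degree q}
  have hH : Submodule.span (MvPolynomial σ k) H = A.Z := by
    refine le_antisymm (Submodule.span_le.2 fun v hv => hv.1) fun v hv => ?_
    have hle : ⨆ q, freeGrading k σ A.degree q ⊓ A.Z.toAddSubgroup ≤
        (Submodule.span (MvPolynomial σ k) H).toAddSubgroup := by
      refine iSup_le fun q w hw => ?_
      rcases lt_or_ge q 0 with hq | hq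
      · have : w = 0 := funext fun j =>
          eq_zero_of_mem_polyGrading_of_neg (by omega) (hw.1 j)
        exact this ▸ zero_mem _
      · lift q to ℕ using hq
        exact Submodule.subset_span ⟨hw.2, q, hw.1⟩
    exact hle (A.homogeneous v hv)
  obtain ⟨t, ht, ht'⟩ := (Submodule.fg_span_iff_fg_span_finset_subset H).1
    (IsNoetherian.noetherian (R := MvPolynomial σ k) _)
  have hq (l : Fin t.card) : ∃ q : ℕ,
      ((t.equivFin.symm l : t) : Fin A.rank → MvPolynomial σ k) ∈ freeGrading k σ A.degree q := (ht (t.equivFin.symm l).2).2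
  choose deg hdeg using hq
  refine ⟨t.card, deg, fun l => t.equivFin.symm l, hdeg, ?_⟩
  have : Set.range (fun l => ((t.equivFin.symm l : t) : Fin A.rank → MvPolynomial σ k)) = t := by
    rw [show (fun l => ((t.equivFin.symm l : t) : Fin A.rank → MvPolynomial σ k)) =
      Subtype.val ∘ t.equivFin.symm from rfl, Set.range_comp, Equiv.range_eq_univ,
      Set.image_univ, Subtype.range_coe]
  rw [this, ← ht', hH]

/-- The matrix whose columns are the vectors `z`. -/
def colMatrix {m n : ℕ} (z : Fin n → (Fin m → MvPolynomial σ k)) :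
    Matrix (Fin m) (Fin n) (MvPolynomial σ k) := Matrix.of fun j l => z l j

theorem colMatrix_mulVecLin {m n : ℕ} (z : Fin n → (Fin m → MvPolynomial σ k))
    (w : Fin n → MvPolynomial σ k) : (colMatrix z).mulVecLin w = ∑ l, w l • z l := by
  funext j
  simp [colMatrix, Matrix.mulVec, dotProduct, mul_comm]

theorem range_colMatrix {m n : ℕ} (z : Fin n → (Fin m → MvPolynomial σ k)) :
    LinearMap.range (colMatrix z).mulVecLin = Submodule.span _ (Set.range z) := by
  rw [Matrix.range_mulVecLin]
  rfl

theorem colMatrix_mem {m n : ℕ} {deg : Fin m → ℕ} {deg' : Fin n → ℕ}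
    {z : Fin n → (Fin m → MvPolynomial σ k)} (hz : ∀ l, z l ∈ freeGrading k σ deg (deg' l)) (j l) :
    colMatrix z j l ∈ polyGrading σ k ((deg' l : ℤ) - deg j) := hz l j

theorem ker_colMatrix_le {m n : ℕ} {deg : Fin m → ℕ} {deg' : Fin n → ℕ}
    {z : Fin n → (Fin m → MvPolynomial σ k)} (hz : ∀ l, z l ∈ freeGrading k σ deg (deg' l))
    {w : Fin n → MvPolynomial σ k} (hw : (colMatrix z).mulVecLin w = 0) :
    w ∈ ⨆ q, kerGrading (freeGrading k σ deg') (colMatrix z).mulVecLin q :=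
  ker_le_iSup _ (mulVec_mem_freeGrading (colMatrix_mem hz)) iSupIndep_freeGrading hw

theorem eq_C_of_mem_polyGrading_zero {f : MvPolynomial σ k} (hf : f ∈ polyGrading σ k 0) :
    f = C (constantCoeff f) := by
  classical
  ext m
  rw [coeff_C]
  split_ifs with h
  · rw [← h]; rfl
  · by_contra h0
    have := hf m h0
    rw [Nat.cast_eq_zero, Finsupp.degree_eq_zero_iff] at this
    exact h this.symm

/-- A relation with a unit coefficient between homogeneous generators makes one of them
superfluous. -/
theorem Stage.Generates.constantCoeff_eq_zero {A : Stage k σ} {n : ℕ} {deg : Fin n → ℕ}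
    {z : Fin n → (Fin A.rank → MvPolynomial σ k)} (h : A.Generates deg z)
    (hmin : ∀ n' < n, ¬ ∃ (deg : Fin n' → ℕ) (z : _), A.Generates deg z)
    {w : Fin n → MvPolynomial σ k} (hw : (colMatrix z).mulVecLin w = 0) (l : Fin n) :
    constantCoeff (w l) = 0 := by
  let T : AddSubgroup (Fin n → MvPolynomial σ k) :=
    { carrier := {w | constantCoeff (w l) = 0}
      zero_mem' := by simp
      add_mem' := fun {v w} hv hw => by
        simp only [Set.mem_ofPred_eq] at hv hw; simp [hv, hw]
      neg_mem' := fun {v} hv => by simp only [Set.mem_ofPred_eq] at hv; simp [hv] }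
  suffices hT : ⨆ q, kerGrading (freeGrading k σ deg) (colMatrix z).mulVecLin q ≤ T from
    hT (ker_colMatrix_le h.1 hw)
  refine iSup_le fun q v hv => ?_
  by_contra h0
  change ¬ constantCoeff (v l) = 0 at h0
  -- A nonzero constant term forces the l-th coordinate to have degree zero, so it is a unit
  -- constant and `z l` can be solved for.
  have hq : q - deg l = 0 := by
    have := hv.1 l 0 h0
    simpa using this.symm
  have hvl : v l ∈ polyGrading σ k (q - deg l) := hv.1 l
  rw [hq] at hvl
  have hC := eq_C_of_mem_polyGrading_zero hvl
  cases n with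
  | zero => exact l.elim0
  | succ n =>
    refine hmin n n.lt_succ_self ⟨deg ∘ l.succAbove, z ∘ l.succAbove, fun i => h.1 _, ?_⟩
    have hrel : ∑ l, v l • z l = 0 := (colMatrix_mulVecLin z v).symm.trans hv.2
    rw [Fin.sum_univ_succAbove _ l, hC, add_eq_zero_iff_eq_neg] at hrel
    have hmem : z l ∈ Submodule.span (MvPolynomial σ k) (Set.range (z ∘ l.succAbove)) := by
      have h1 : (C (constantCoeff (v l)) : MvPolynomial σ k) • z l ∈
          Submodule.span (MvPolynomial σ k) (Set.range (z ∘ l.succAbove)) := by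
        rw [hrel]
        exact neg_mem (sum_mem fun i _ => Submodule.smul_mem _ _
          (Submodule.subset_span ⟨i, rfl⟩))
      have h2 := Submodule.smul_mem _ (C (constantCoeff (v l))⁻¹ : MvPolynomial σ k) h1
      rwa [smul_smul, ← C_mul, inv_mul_cancel₀ h0, C_1, one_smul] at h2
    rw [← h.2]
    refine le_antisymm (Submodule.span_mono (Set.range_comp_subset_range _ _))
      (Submodule.span_le.2 ?_)
    rintro _ ⟨i, rfl⟩
    rcases Fin.eq_self_or_eq_succAbove l i with rfl | ⟨j, rfl⟩
    · exact hmem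
    · exact Submodule.subset_span ⟨j, rfl⟩

/-- `Nat.find` takes the least number of homogeneous generators; this minimality puts the relations
into the maximal multiple, so that the kernel is again a stage. -/
theorem Stage.exists_next [Finite σ] (A : Stage k σ) :
    ∃ (B : Stage k σ) (D : Matrix (Fin A.rank) (Fin B.rank) (MvPolynomial σ k)),
      (∀ j l, D j l ∈ polyGrading σ k ((B.degree l : ℤ) - A.degree j)) ∧
      LinearMap.range D.mulVecLin = A.Z ∧ B.Z = LinearMap.ker D.mulVecLin ∧
      ∀ j l, constantCoeff (D j l) = 0 := by
  classical
  have hex := A.exists_generates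
  obtain ⟨deg, z, h⟩ := Nat.find_spec hex
  refine ⟨⟨Nat.find hex, deg, LinearMap.ker (colMatrix z).mulVecLin,
    fun v hv => ker_colMatrix_le h.1 hv,
    fun v hv => h.constantCoeff_eq_zero (fun n' hn' => Nat.find_min hex hn') hv⟩,
    colMatrix z, colMatrix_mem h.1, by rw [range_colMatrix, h.2], rfl, fun j l => ?_⟩
  refine A.constantCoeff_eq_zero (z l) ?_ j
  rw [← h.2]
  exact Submodule.subset_span ⟨l, rfl⟩

variable [Finite σ]

/-- The stage that consists of the syzygies of a minimal set of homogeneous generators. -/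
noncomputable def Stage.next (A : Stage k σ) : Stage k σ := A.exists_next.choose

/-- The matrix of a minimal set of homogeneous generators. -/
noncomputable def Stage.matrix (A : Stage k σ) :
    Matrix (Fin A.rank) (Fin A.next.rank) (MvPolynomial σ k) := A.exists_next.choose_spec.choose

theorem Stage.matrix_spec (A : Stage k σ) :
    (∀ j l, A.matrix j l ∈ polyGrading σ k ((A.next.degree l : ℤ) - A.degree j)) ∧
      LinearMap.range A.matrix.mulVecLin = A.Z ∧ A.next.Z = LinearMap.ker A.matrix.mulVecLin ∧
      ∀ j l, constantCoeff (A.matrix j l) = 0 := A.exists_next.choose_spec.choose_spec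

/-- The iterated syzygies. -/
noncomputable def Stage.iter (A : Stage k σ) : ℕ → Stage k σ
  | 0 => A
  | i + 1 => (A.iter i).next

variable {M : Type*} [AddCommGroup M] [Module (MvPolynomial σ k) M] {γ : ℤ → AddSubgroup M}

/-- A minimal graded cover of a module extends to a minimal graded free resolution. -/
noncomputable def Stage.resolution (A : Stage k σ)
    (aug : (Fin A.rank → MvPolynomial σ k) →ₗ[MvPolynomial σ k] M)
    (hker : A.Z = LinearMap.ker aug)
    (haug : ∀ q, ∀ v ∈ freeGrading k σ A.degree q, aug v ∈ γ q)
    (hs : Function.Surjective aug) : Resolution k σ γ where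
  rank i := (A.iter i).rank
  degree i := (A.iter i).degree
  aug := aug
  D i := (A.iter i).matrix
  aug_mem := haug
  D_mem i := (A.iter i).matrix_spec.1
  surjective := hs
  exact_zero := show Function.Exact A.matrix.mulVecLin aug from
    LinearMap.exact_iff.2 (hker.symm.trans A.matrix_spec.2.1.symm)
  exact_succ i := show Function.Exact (A.iter i).next.matrix.mulVecLin (A.iter i).matrix.mulVecLin from
    LinearMap.exact_iff.2
      ((A.iter i).matrix_spec.2.2.1.symm.trans (A.iter i).next.matrix_spec.2.1.symm)
  minimal i := (A.iter i).matrix_spec.2.2.2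

/-- A graded module generated by one element of degree zero has a minimal graded free
resolution. -/
theorem exists_resolution_of_cyclic (hγ : iSupIndep γ) (r : M)
    (hr : ∀ q, ∀ f ∈ polyGrading σ k q, f • r ∈ γ q) (hs : ∀ m : M, ∃ f : MvPolynomial σ k, f • r = m)
    (hc : ∀ f : MvPolynomial σ k, f • r = 0 → constantCoeff f = 0) :
    Nonempty (Resolution k σ γ) := by
  let aug : (Fin 1 → MvPolynomial σ k) →ₗ[MvPolynomial σ k] M :=
    (LinearMap.toSpanSingleton _ M r).comp (LinearMap.proj 0)
  have haug : ∀ q, ∀ v ∈ freeGrading k σ (fun _ : Fin 1 => 0) q, aug v ∈ γ q := by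
    intro q v hv
    have : v 0 ∈ polyGrading σ k (q - (0 : ℕ)) := hv 0
    rw [Nat.cast_zero, sub_zero] at this
    exact hr q _ this
  let A : Stage k σ :=
    { rank := 1
      degree := fun _ => 0
      Z := LinearMap.ker aug
      homogeneous := fun v hv => ker_le_iSup aug haug hγ hv
      constantCoeff_eq_zero := fun v hv j => by
        rw [Subsingleton.elim j 0]
        exact hc _ hv }
  refine ⟨A.resolution aug rfl haug fun m => ?_⟩
  obtain ⟨f, hf⟩ := hs m
  exact ⟨fun _ => f, hf⟩

end Step

end Koszul

namespace Koszul

open MvPolynomial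

/-! ### Regularity as the last nonzero strand -/

section Regularity

variable {σ k R : Type*} [Field k] [CommRing R] [Algebra k R] [Module (MvPolynomial σ k) R]
  {φ : MvPolynomial σ k →ₐ[k] R} {𝒜 : ℕ → Submodule k R} {γ : ℤ → AddSubgroup R}

theorem coe_linearCombination (hsmul : ∀ (f : MvPolynomial σ k) (r : R), f • r = φ f * r) {n : ℕ}
    (r : Fin n → R) : ⇑(Fintype.linearCombination (MvPolynomial σ k) r) =
      fun v : Fin n → MvPolynomial σ k => ∑ j, φ (v j) * r j := by
  funext v
  simp [Fintype.linearCombination_apply, hsmul]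

/-- A minimal graded free resolution in the sense of `MinimalGradedFreeResolution`. -/
noncomputable def Resolution.ofMinimal (hsmul : ∀ (f : MvPolynomial σ k) (r : R), f • r = φ f * r)
    (hγ : ∀ n r, r ∈ 𝒜 n ↔ r ∈ γ n)
    (hmul : ∀ p q, ∀ f ∈ polyGrading σ k p, ∀ r ∈ γ q, f • r ∈ γ (p + q))
    (F : MinimalGradedFreeResolution φ 𝒜) : Resolution k σ γ where
  rank := F.rank
  degree := F.degree
  aug := Fintype.linearCombination (MvPolynomial σ k) F.gen
  D := F.D
  aug_mem q v hv := by
    rw [Fintype.linearCombination_apply]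
    refine sum_mem fun j _ => ?_
    have := hmul _ _ _ (hv j) _ ((hγ _ _).1 (F.gen_mem j))
    rwa [sub_add_cancel] at this
  D_mem i j l := by
    rcases F.D_homogeneous i j l with h | ⟨m, hm, h⟩
    · rw [h]; exact zero_mem _
    · rw [← hm, Nat.cast_add, add_sub_cancel_left]
      exact mem_polyGrading_natCast.2 h
  surjective := by
    rw [coe_linearCombination hsmul]
    exact F.surjective
  exact_zero := by
    rw [coe_linearCombination hsmul]
    exact F.exact_zero
  exact_succ := F.exact_succ
  minimal := F.minimal

/-- A finite resolution as a `MinimalGradedFreeResolution`. -/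
noncomputable def Resolution.toMinimal (hsmul : ∀ (f : MvPolynomial σ k) (r : R), f • r = φ f * r)
    (hγ : ∀ n r, r ∈ 𝒜 n ↔ r ∈ γ n) (F : Resolution k σ γ)
    (hF : ∃ p : ℕ, ∀ i, p < i → F.rank i = 0) : MinimalGradedFreeResolution φ 𝒜 :=
  have haug : F.aug = fun v : Fin (F.rank 0) → MvPolynomial σ k =>
      ∑ j, φ (v j) * F.aug (Pi.single j 1) := by
    classical
    funext v
    simp_rw [← hsmul, ← map_smul, ← map_sum]
    congr 1
    funext j
    simp [Pi.single_apply]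
  { rank := F.rank
    degree := F.degree
    gen := fun j => F.aug (Pi.single j 1)
    D := F.D
    finite_length := hF
    gen_mem := fun j => by
      rw [hγ]
      refine F.aug_mem _ _ fun i => ?_
      by_cases hij : i = j
      · subst hij
        rw [Pi.single_eq_same]
        show (1 : MvPolynomial σ k) ∈ polyGrading σ k ((F.degree 0 i : ℤ) - F.degree 0 i)
        rw [sub_self]
        exact_mod_cast mem_polyGrading_natCast.2 (isHomogeneous_one σ k)
      · rw [Pi.single_eq_of_ne hij]; exact zero_mem _
    D_homogeneous := fun i j l => by
      have h := F.D_mem i j l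
      -- An entry of negative degree is zero, which is the first alternative of `D_homogeneous`.
      rcases lt_or_ge ((F.degree (i + 1) l : ℤ) - F.degree i j) 0 with h0 | h0
      · exact Or.inl (eq_zero_of_mem_polyGrading_of_neg h0 h)
      · refine Or.inr ⟨F.degree (i + 1) l - F.degree i j, by omega, ?_⟩
        rw [← mem_polyGrading_natCast, Nat.cast_sub (by omega)]
        exact h
    surjective := haug ▸ F.surjective
    exact_zero := haug ▸ F.exact_zero
    exact_succ := F.exact_succ
    minimal := F.minimal }

/-- The regularity of a graded quotient of a polynomial ring is the last strand in which the
Koszul homology of the variables is nonzero. -/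
theorem hasRegularity_of_vanish [Finite σ]
    (hsmul : ∀ (f : MvPolynomial σ k) (r : R), f • r = φ f * r)
    (hγ : ∀ n r, r ∈ 𝒜 n ↔ r ∈ γ n)
    (hmul : ∀ p q, ∀ f ∈ polyGrading σ k p, ∀ r ∈ γ q, f • r ∈ γ (p + q))
    (hind : iSupIndep γ) (h1 : (1 : R) ∈ γ 0) (hφ : Function.Surjective φ)
    (hc : ∀ f, φ f = 0 → constantCoeff f = 0) {l : List σ} (hl : l.Nodup) (hl' : ∀ s, s ∈ l)
    {m : ℤ} (h : ∀ i q, m < q → Vanish (varList k l) γ i q)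
    (h' : ∃ i, ¬ Vanish (varList k l) γ i m) : HasRegularity φ 𝒜 m := by
  refine ⟨?_, fun F => (Resolution.ofMinimal hsmul hγ hmul F).isGreatest hind hl hl' h h'⟩
  obtain ⟨F⟩ := exists_resolution_of_cyclic (k := k) (σ := σ) hind (1 : R)
    (fun q f hf => by simpa using hmul q 0 f hf 1 h1)
    (fun r => by
      obtain ⟨f, hf⟩ := hφ r
      exact ⟨f, by rw [hsmul, mul_one, hf]⟩)
    (fun f hf => hc f (by rwa [hsmul, mul_one] at hf))
  exact ⟨F.toMinimal hsmul hγ ⟨l.length, fun i hi => F.rank_eq_zero hind hl hl' hi⟩⟩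

end Regularity

end Koszul

namespace MonomialCurve

open MvPolynomial

/-! ### Sums of exponents from the three intervals -/

section Sums

/-- `i` is a sum of `n` elements of `A`. -/
def SumOf (A : Set ℕ) (n i : ℕ) : Prop :=
  ∃ L : List ℕ, L.length = n ∧ L.sum = i ∧ ∀ x ∈ L, x ∈ A

theorem SumOf.mono {A B : Set ℕ} {n i : ℕ} (h : SumOf A n i) (hAB : A ⊆ B) : SumOf B n i := by
  obtain ⟨L, h1, h2, h3⟩ := h
  exact ⟨L, h1, h2, fun x hx => hAB (h3 x hx)⟩

theorem SumOf.add {A : Set ℕ} {n n' i i' : ℕ} (h : SumOf A n i) (h' : SumOf A n' i') :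
    SumOf A (n + n') (i + i') := by
  obtain ⟨L, rfl, rfl, h3⟩ := h
  obtain ⟨L', rfl, rfl, h3'⟩ := h'
  exact ⟨L ++ L', List.length_append, List.sum_append, fun x hx =>
    (List.mem_append.1 hx).elim (h3 x) (h3' x)⟩

theorem sumOf_Icc {lo hi n i : ℕ} (h : n * lo ≤ i) (h' : i ≤ n * hi) :
    SumOf (Set.Icc lo hi) n i := by
  induction n generalizing i with
  | zero => exact ⟨[], rfl, by simp; omega, by simp⟩
  | succ n ih =>
    have hlh : lo ≤ hi := Nat.le_of_mul_le_mul_left (h.trans h') n.succ_pos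
    rw [add_mul, one_mul] at h h'
    have hn := Nat.mul_le_mul_left n hlh
    -- The last summand s is taken as large as possible while leaving at least n * lo for the
    -- others.
    obtain ⟨s, hs1, hs2, hs3, hs4⟩ : ∃ s, lo ≤ s ∧ s ≤ hi ∧ n * lo + s ≤ i ∧ i ≤ n * hi + s := by
      rcases le_total i (n * lo + hi) with h0 | h0
      · exact ⟨i - n * lo, by omega, by omega, by omega, by omega⟩
      · exact ⟨hi, hlh, le_rfl, h0, by omega⟩
    have := (ih (i := i - s) (by omega) (by omega)).add (n' := 1) (i' := s)
      ⟨[s], rfl, by simp, by simp [hs1, hs2]⟩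
    rwa [Nat.sub_add_cancel (by omega)] at this

/-- If `j` summands lie in `[e, d]`, `s` in `[b, c]` and `t` in `[0, a]`, all the values between
the extremes occur. -/
theorem sumOf_threeIntervals {a b c d e j s t i : ℕ} (hbc : b ≤ c) (hed : e ≤ d)
    (h : j * e + s * b ≤ i) (h' : i ≤ j * d + s * c + t * a) :
    SumOf (threeIntervals a b c d e) (j + s + t) i := by
  have h1 := Nat.mul_le_mul_left j hed
  have h2 := Nat.mul_le_mul_left s hbc
  obtain ⟨u, v, w, hu, hu', hv, hv', hw, rfl⟩ : ∃ u v w, j * e ≤ u ∧ u ≤ j * d ∧ s * b ≤ v ∧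
      v ≤ s * c ∧ w ≤ t * a ∧ u + v + w = i := by
    rcases le_total i (j * d + s * b) with h3 | h3
    · exact ⟨i - s * b, s * b, 0, by omega, by omega, by omega, by omega, by omega, by omega⟩
    · rcases le_total i (j * d + s * c) with h4 | h4
      · exact ⟨j * d, i - j * d, 0, by omega, by omega, by omega, by omega, by omega, by omega⟩
      · exact ⟨j * d, s * c, i - j * d - s * c, by omega, by omega, by omega, by omega, by omega,
          by omega⟩
  refine (((sumOf_Icc hu hu').mono fun x hx => Or.inr hx).add
    ((sumOf_Icc hv hv').mono fun x hx => Or.inl (Or.inr hx))).add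
    ((sumOf_Icc (lo := 0) (by omega) hw).mono fun x hx => Or.inl (Or.inl hx))

/-- Take as many summands from [e, d] as i permits, and the other t from [0, a]. If i exceeds jd +
ta, replacing one summand of [0, a] by one of [b, c] suffices. -/
theorem sumOf_of_le {a b c d e m n i : ℕ} (hab : a < b) (hbc : b ≤ c) (hce : c < e) (hed : e < d)
    (hend : a ≤ d - e) (hgap : e - c ≤ b - a) (hm : b ≤ m * a + 1) (hmn : m ≤ n)
    (hi : i ≤ n * d) : SumOf (threeIntervals a b c d e) n i := by
  have hn : b ≤ n * a + 1 := hm.trans (by gcongr)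
  obtain ⟨j, hj, hji, hj'⟩ : ∃ j ≤ n, j * e ≤ i ∧ (j < n → i < (j + 1) * e) := by
    rcases le_or_gt n (i / e) with h | h
    · exact ⟨n, le_rfl, (Nat.mul_le_mul_right e h).trans (Nat.div_mul_le_self i e),
        fun h => absurd h (lt_irrefl n)⟩
    · exact ⟨i / e, h.le, Nat.div_mul_le_self i e, fun _ => by
        rw [← Nat.div_lt_iff_lt_mul (by omega)]; exact Nat.lt_succ_self _⟩
  obtain ⟨t, rfl⟩ := Nat.exists_eq_add_of_le hj
  have hjd : j * e + j * a ≤ j * d := by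
    rw [← mul_add]; exact Nat.mul_le_mul_left j (by omega)
  rw [add_mul] at hn hi
  rcases le_or_gt i (j * d + t * a) with h | h
  · exact sumOf_threeIntervals (s := 0) hbc hed.le (by omega) (by omega)
  · cases t with
    | zero => omega
    | succ t =>
      have h1 := hj' (by omega)
      rw [add_mul, one_mul] at h1
      rw [add_mul t 1 a, one_mul] at h hn
      -- Lower bound: i > jd + ta ≥ je + na ≥ je + b - 1. Upper bound: i ≤ je + e - 1, where je ≤ jd
      -- - ja, e ≤ c + b - a and b ≤ na + 1, whence i ≤ jd + c plus a for each remaining summand.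
      have := sumOf_threeIntervals (a := a) (b := b) (c := c) (j := j) (s := 1) (t := t) (i := i)
        hbc hed.le (by omega) (by omega)
      rwa [add_assoc, add_comm 1 t] at this

end Sums

end MonomialCurve

namespace MonomialCurve

open MvPolynomial Koszul

/-! ### Monomials and forms in the ring -/

section Ring

variable {k : Type*} [Field k] {d : ℕ} {A : Set ℕ}

theorem degree_fin_two (m : Fin 2 →₀ ℕ) : m.degree = m 0 + m 1 := by
  rw [Finsupp.degree_eq_sum, Fin.sum_univ_two]

theorem monomial_fin_two (m : Fin 2 →₀ ℕ) (c : k) :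
    monomial m c = c • (X 0 ^ m 0 * X 1 ^ m 1 : MvPolynomial (Fin 2) k) := by
  rw [monomial_eq, Finsupp.prod_fintype _ _ (by simp), Fin.prod_univ_two, smul_eq_C_mul]

theorem isHomogeneous_mono (hA : ∀ α ∈ A, α ≤ d) {α : ℕ} (hα : α ∈ A) :
    (mono k d α).IsHomogeneous d := by
  have := (isHomogeneous_X_pow (R := k) (0 : Fin 2) α).mul (isHomogeneous_X_pow 1 (d - α))
  rwa [Nat.add_sub_cancel' (hA α hα)] at this

/-- The grading of the ring by the integers. -/
noncomputable def grading (k : Type*) [Field k] (d : ℕ) (A : Set ℕ) (q : ℤ) : AddSubgroup (ring k d A) :=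
  (polyGrading (Fin 2) k (q * d)).comap (ring k d A).val.toLinearMap.toAddMonoidHom

theorem mem_grading {q : ℤ} {r : ring k d A} :
    r ∈ grading k d A q ↔ (r : MvPolynomial (Fin 2) k) ∈ polyGrading (Fin 2) k (q * d) := Iff.rfl

theorem mem_grading_natCast {n : ℕ} {r : ring k d A} :
    r ∈ grading k d A n ↔ (r : MvPolynomial (Fin 2) k).IsHomogeneous (n * d) := by
  rw [mem_grading, ← mem_polyGrading_natCast, Nat.cast_mul]

theorem mem_component {n : ℕ} {r : ring k d A} :
    r ∈ component k d A n ↔ r ∈ grading k d A n := by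
  rw [mem_grading_natCast]
  rfl

theorem iSupIndep_grading (hd : 0 < d) : iSupIndep (grading k d A) := by
  intro q
  rw [disjoint_iff_inf_le]
  rintro r ⟨hr, hr'⟩
  let T : AddSubgroup (ring k d A) :=
    { carrier := {r | ∀ m : Fin 2 →₀ ℕ, (m.degree : ℤ) = q * d → coeff m r.1 = 0}
      zero_mem' := fun m _ => coeff_zero m
      add_mem' := fun {r s} hr hs m h => by simp [hr m h, hs m h]
      neg_mem' := fun {r} hr m h => by simp [hr m h] }
  have hT : ⨆ p, ⨆ (_ : p ≠ q), grading k d A p ≤ T := by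
    refine iSup₂_le fun p hp s hs m hm => ?_
    by_contra h0
    have h1 := hs m h0
    rw [hm] at h1
    exact hp (mul_right_cancel₀ (Nat.cast_ne_zero.2 hd.ne') h1).symm
  refine AddSubgroup.mem_bot.2 (Subtype.ext ?_)
  ext m
  by_contra h0
  exact h0 (hT hr' m (hr m h0))

theorem coe_presentation (f : MvPolynomial A k) :
    (presentation k d A f : MvPolynomial (Fin 2) k) = aeval (fun α : A => mono k d α) f := by
  have : (ring k d A).val.comp (presentation k d A) = aeval (fun α : A => mono k d α) :=
    algHom_ext fun α => by simp [presentation, generator]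
  exact DFunLike.congr_fun this f

theorem presentation_X (α : A) : presentation k d A (X α) = generator k d A α := aeval_X _ _

theorem presentation_surjective : Function.Surjective (presentation k d A) := by
  rintro ⟨r, hr⟩
  rw [ring, Set.image_eq_range, Algebra.adjoin_range_eq_range_aeval] at hr
  obtain ⟨f, hf⟩ := hr
  exact ⟨f, Subtype.ext ((coe_presentation f).trans hf)⟩

theorem constantCoeff_presentation (hd : 0 < d) (f : MvPolynomial A k) :
    constantCoeff (presentation k d A f : MvPolynomial (Fin 2) k) = constantCoeff f := by
  rw [coe_presentation]
  have : (constantCoeff.comp (aeval (fun α : A => mono k d α)).toRingHom :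
      MvPolynomial A k →+* k) = constantCoeff := by
    refine ringHom_ext (fun c => by simp) fun α => ?_
    rcases Nat.eq_zero_or_pos (α : ℕ) with h | h
    · simp [mono, h, hd.ne']
    · simp [mono, h.ne']
  exact DFunLike.congr_fun this f

theorem presentation_mul_mem_grading (hA : ∀ α ∈ A, α ≤ d) (p q : ℤ) (f : MvPolynomial A k)
    (hf : f ∈ polyGrading A k p) (r : ring k d A) (hr : r ∈ grading k d A q) :
    presentation k d A f * r ∈ grading k d A (p + q) := by
  have h : (presentation k d A f : MvPolynomial (Fin 2) k) ∈ polyGrading (Fin 2) k (p * d) := by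
    rcases lt_or_ge p 0 with hp | hp
    · rw [eq_zero_of_mem_polyGrading_of_neg hp hf, map_zero]; exact zero_mem _
    · lift p to ℕ using hp
      rw [mem_polyGrading_natCast] at hf
      rw [coe_presentation, mul_comm]
      exact_mod_cast mem_polyGrading_natCast.2
        (hf.aeval (fun α : A => mono k d α) fun α => isHomogeneous_mono hA α.2)
  rw [mem_grading, add_mul]
  exact mul_mem_polyGrading h hr

theorem generator_mem_grading (hA : ∀ α ∈ A, α ≤ d) (α : A) :
    generator k d A α ∈ grading k d A (1 : ℕ) := by
  rw [mem_grading_natCast, one_mul]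
  exact isHomogeneous_mono hA α.2

theorem generator_mem_irrelevant (hA : ∀ α ∈ A, α ≤ d) (α : A) :
    generator k d A α ∈ irrelevant k d A :=
  Ideal.subset_span ⟨1, le_rfl, mem_component.2 (generator_mem_grading hA α)⟩

theorem exists_of_sumOf (hA : ∀ α ∈ A, α ≤ d) {n i : ℕ} (h : SumOf A n i) :
    i ≤ n * d ∧ ∃ r ∈ irrelevant k d A ^ n,
      (r : MvPolynomial (Fin 2) k) = X 0 ^ i * X 1 ^ (n * d - i) := by
  obtain ⟨L, rfl, rfl, hL⟩ := h
  induction L with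
  | nil => exact ⟨by simp, 1, by simp, by simp⟩
  | cons α L ih =>
    rw [List.forall_mem_cons] at hL
    obtain ⟨h1, r, hr, hr'⟩ := ih hL.2
    have hα := hA α hL.1
    rw [List.sum_cons, List.length_cons, add_mul, one_mul]
    refine ⟨by omega, generator k d A ⟨α, hL.1⟩ * r, ?_, ?_⟩
    · rw [pow_succ']
      exact Ideal.mul_mem_mul (generator_mem_irrelevant hA _) hr
    · rw [show L.length * d + d - (α + L.sum) = (d - α) + (L.length * d - L.sum) by omega,
        pow_add, pow_add, Subalgebra.coe_mul, hr']
      simp only [generator, mono]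
      ring

/-- If all the exponents up to `n * d` are sums of `n` elements of `A`, then all the forms of degree
`n * d` lie in the ring, and in the `n`-th power of its irrelevant ideal. -/
theorem exists_of_isHomogeneous (hA : ∀ α ∈ A, α ≤ d) {n : ℕ} (h : ∀ i ≤ n * d, SumOf A n i)
    {f : MvPolynomial (Fin 2) k} (hf : f.IsHomogeneous (n * d)) :
    ∃ r ∈ irrelevant k d A ^ n, (r : MvPolynomial (Fin 2) k) = f := by
  suffices hN : f ∈ ((irrelevant k d A ^ n).restrictScalars k).map
      (ring k d A).val.toLinearMap from hN
  rw [f.as_sum]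
  refine sum_mem fun m hm => ?_
  rw [monomial_fin_two]
  refine Submodule.smul_mem _ _ ?_
  have hm' := mem_polyGrading_natCast.2 hf m (mem_support_iff.1 hm)
  rw [degree_fin_two, Nat.cast_inj] at hm'
  obtain ⟨-, r, hr, hr'⟩ := exists_of_sumOf (k := k) hA (h (m 0) (by omega))
  refine ⟨r, hr, hr'.trans ?_⟩
  rw [← hm', Nat.add_sub_cancel_left]

/-- A sum of n exponents either uses only [0, a], and is at most na, or has a summand that is at
least b. -/
theorem support_of_mem_ring {a b c e : ℕ} (hbc : b ≤ c) (hce : c < e) (hed : e < d)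
    (hab : a < b) {r : MvPolynomial (Fin 2) k} (hr : r ∈ ring k d (threeIntervals a b c d e)) :
    ∀ m, coeff m r ≠ 0 → ∃ n, m 0 + m 1 = n * d ∧ (m 0 ≤ n * a ∨ b ≤ m 0) := by
  classical
  induction hr using Algebra.adjoin_induction with
  | mem x hx =>
    obtain ⟨α, hα, rfl⟩ := hx
    intro m hm
    have hαd : α ≤ d := by
      rcases hα with (⟨-, h⟩ | ⟨-, h⟩) | ⟨-, h⟩ <;> omega
    have hm' : m = Finsupp.single 0 α + Finsupp.single 1 (d - α) := by
      by_contra h0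
      apply hm
      rw [mono, X_pow_eq_monomial, X_pow_eq_monomial, monomial_mul, coeff_monomial,
        if_neg (Ne.symm h0)]
    subst hm'
    refine ⟨1, by simp; omega, ?_⟩
    rcases hα with (⟨-, h⟩ | ⟨h, -⟩) | ⟨h, -⟩
    · left; simpa using h
    · right; simpa using h
    · right; simp; omega
  | algebraMap x =>
    intro m hm
    rw [MvPolynomial.algebraMap_eq, coeff_C] at hm
    split_ifs at hm with h
    · subst h; exact ⟨0, by simp, by simp⟩
    · exact absurd rfl hm
  | add x y _ _ hx hy =>
    intro m hm
    by_cases h0 : coeff m x = 0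
    · exact hy m fun h1 => hm (by rw [coeff_add, h0, h1, add_zero])
    · exact hx m h0
  | mul x y _ _ hx hy =>
    intro m hm
    rw [coeff_mul] at hm
    obtain ⟨⟨s, t⟩, hst, h⟩ := Finset.exists_ne_zero_of_sum_ne_zero hm
    rw [Finset.HasAntidiagonal.mem_antidiagonal] at hst
    obtain ⟨n, hn, hn'⟩ := hx s (left_ne_zero_of_mul h)
    obtain ⟨n', hn1, hn1'⟩ := hy t (right_ne_zero_of_mul h)
    subst hst
    refine ⟨n + n', ?_, ?_⟩
    · simp only [Finsupp.add_apply, add_mul]; omega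
    · simp only [Finsupp.add_apply, add_mul]; omega

theorem X_pow_dvd_of_coeff {s : Fin 2} {n N : ℕ} {f : MvPolynomial (Fin 2) k}
    (hf : f.IsHomogeneous (N + n)) (h : ∀ m, coeff m f ≠ 0 → n ≤ m s) :
    ∃ g : MvPolynomial (Fin 2) k, g.IsHomogeneous N ∧ f = X s ^ n * g := by
  refine ⟨f.divMonomial (Finsupp.single s n), ?_, ?_⟩
  · rw [← mem_polyGrading_natCast]
    intro m hm
    rw [coeff_divMonomial] at hm
    have := mem_polyGrading_natCast.2 hf _ hm
    simp only [map_add, Finsupp.degree_single] at this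
    push_cast at this
    omega
  · have := divMonomial_add_modMonomial f (Finsupp.single s n)
    have h0 : f.modMonomial (Finsupp.single s n) = 0 := by
      ext m
      by_cases hm : Finsupp.single s n ≤ m
      · rw [coeff_modMonomial_of_le _ hm, coeff_zero]
      · rw [coeff_modMonomial_of_not_le _ hm, coeff_zero]
        by_contra h1
        exact hm (Finsupp.single_le_iff.2 (h m h1))
    rw [h0, add_zero] at this
    rw [X_pow_eq_monomial, this]

/-- A monomial of degree (n+1)d not divisible by x^d has y-exponent above nd, hence at least d since
n ≥ 1. -/
theorem exists_split {n : ℕ} (hn : 1 ≤ n) {f : MvPolynomial (Fin 2) k}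
    (hf : f.IsHomogeneous ((n + 1) * d)) :
    ∃ g h : MvPolynomial (Fin 2) k, g.IsHomogeneous (n * d) ∧ h.IsHomogeneous (n * d) ∧
      f = X 0 ^ d * g + X 1 ^ d * h := by
  rw [add_mul, one_mul] at hf
  have hfm := mem_polyGrading_natCast.2 hf
  let s : Fin 2 →₀ ℕ := Finsupp.single 0 d
  have hmod : f.modMonomial s ∈ polyGrading (Fin 2) k ((n * d + d : ℕ) : ℤ) ∧
      ∀ m, coeff m (f.modMonomial s) ≠ 0 → d ≤ m 1 := by
    have (m : Fin 2 →₀ ℕ) (hm : coeff m (f.modMonomial s) ≠ 0) : ¬ s ≤ m ∧ coeff m f ≠ 0 := by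
      by_cases hs : s ≤ m
      · exact absurd (coeff_modMonomial_of_le _ hs) hm
      · exact ⟨hs, by rwa [coeff_modMonomial_of_not_le _ hs] at hm⟩
    refine ⟨fun m hm => hfm m (this m hm).2, fun m hm => ?_⟩
    have h1 := hfm m (this m hm).2
    have h2 := (this m hm).1
    rw [Finsupp.single_le_iff] at h2
    rw [degree_fin_two, Nat.cast_inj] at h1
    have h3 : 1 * d ≤ n * d := Nat.mul_le_mul_right d hn
    omega
  obtain ⟨h, hh, hh'⟩ := X_pow_dvd_of_coeff (mem_polyGrading_natCast.1 hmod.1) hmod.2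
  refine ⟨f.divMonomial s, h, ?_, hh, ?_⟩
  · rw [← mem_polyGrading_natCast]
    intro m hm
    rw [coeff_divMonomial] at hm
    have := hfm _ hm
    simp only [s, map_add, Finsupp.degree_single] at this
    push_cast at this ⊢
    omega
  · rw [← hh', X_pow_eq_monomial, divMonomial_add_modMonomial]

/-- x^d and y^d are coprime; the degree of the quotient is recorded because it decides whether the
quotient lies in the ring. -/
theorem exists_of_X_pow_mul_eq {N : ℕ} {f g : MvPolynomial (Fin 2) k}
    (hf : f.IsHomogeneous (N + d)) (h : X 0 ^ d * f = X 1 ^ d * g) :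
    ∃ g' : MvPolynomial (Fin 2) k, g'.IsHomogeneous N ∧ f = X 1 ^ d * g' := by
  refine X_pow_dvd_of_coeff hf fun m hm => ?_
  by_contra h0
  have := congrArg (coeff (Finsupp.single 0 d + m)) h
  rw [X_pow_eq_monomial, X_pow_eq_monomial, coeff_monomial_mul, one_mul, coeff_monomial_mul',
    if_neg] at this
  · exact hm this
  · rw [Finsupp.single_le_iff]
    simpa using h0

end Ring

end MonomialCurve

namespace MonomialCurve

open MvPolynomial Koszul

/-! ### The parameters x^d, y^d: regularity and reduction number -/

section Parameters

variable {k : Type*} [Field k] {d : ℕ} {A : Set ℕ}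

/-- The ring as a module over the polynomial ring that presents it. -/
noncomputable instance : Module (MvPolynomial A k) (ring k d A) :=
  Module.compHom _ (presentation k d A).toRingHom

theorem presentation_smul (f : MvPolynomial A k) (r : ring k d A) :
    f • r = presentation k d A f * r := rfl

theorem coe_X_smul (α : A) (r : ring k d A) :
    ((X α : MvPolynomial A k) • r : ring k d A) = mono k d α * (r : MvPolynomial (Fin 2) k) := by
  rw [presentation_smul, presentation_X]
  rfl

theorem raises_X_grading (hA : ∀ α ∈ A, α ≤ d) (α : A) :
    Raises (grading k d A) (X α : MvPolynomial A k) := by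
  intro q r hr
  rw [add_comm]
  exact presentation_mul_mem_grading hA _ _ _ (X_mem_polyGrading α) _ hr

theorem mono_self : mono k d d = X 0 ^ d := by simp [mono]

theorem mono_zero : mono k d 0 = X 1 ^ d := by simp [mono]

variable {m : ℕ}

/-- The forms of the degrees from `m` on lie in the ring. -/
def Saturated (k : Type*) [Field k] (d : ℕ) (A : Set ℕ) (m : ℕ) : Prop :=
  ∀ n, m ≤ n → ∀ f : MvPolynomial (Fin 2) k, f.IsHomogeneous (n * d) →
    ∃ r ∈ irrelevant k d A ^ n, (r : MvPolynomial (Fin 2) k) = f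

theorem Saturated.exists_mem_grading (h : Saturated k d A m) {n : ℕ} (hn : m ≤ n)
    {f : MvPolynomial (Fin 2) k} (hf : f.IsHomogeneous (n * d)) :
    ∃ r ∈ grading k d A n, (r : MvPolynomial (Fin 2) k) = f := by
  obtain ⟨r, -, rfl⟩ := h n hn f hf
  exact ⟨r, mem_grading_natCast.2 hf, rfl⟩

/-- The Koszul homology of `x ^ d, y ^ d` vanishes in the strands above `m`. -/
theorem Saturated.vanish (h : Saturated k d A m) (hA : ∀ α ∈ A, α ≤ d) (hm : 1 ≤ m) (h0 : 0 ∈ A)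
    (hd : d ∈ A) (i q : ℤ) (hq : m < q) :
    Vanish (varList k [(⟨d, hd⟩ : A), ⟨0, h0⟩]) (grading k d A) i q := by
  obtain ⟨n, rfl⟩ : ∃ n : ℕ, q = (n + 1 : ℕ) := ⟨(q - 1).toNat, by omega⟩
  have hn : m ≤ n := by omega
  have hq1 : ((n + 1 : ℕ) : ℤ) - 1 = n := by omega
  have hv (p : ℤ) : Vanish (varList k [(⟨0, h0⟩ : A)]) (grading k d A) 1 p := by
    refine vanish_one_cons (raises_X_grading hA _) (vanish_of_length_lt (by simp)) fun r _ hr => ?_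
    have hr' : X (⟨0, h0⟩ : A) • r = 0 := hr
    have hr'' := congrArg Subtype.val hr'
    rw [coe_X_smul, mono_zero] at hr''
    exact Subtype.ext ((mul_eq_zero.1 hr'').resolve_left (pow_ne_zero _ (X_ne_zero 1)))
  rcases lt_trichotomy i 0 with hi | rfl | hi
  · exact vanish_of_neg hi
  · refine vanish_zero_iff.2 fun r hr => ?_
    -- H_0: the cofactors have degree q - 1 ≥ m, so they belong to the ring.
    obtain ⟨f, g, hf, hg, hfg⟩ := exists_split (hm.trans hn) (mem_grading_natCast.1 hr)
    obtain ⟨u, hu, rfl⟩ := h.exists_mem_grading hn hf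
    obtain ⟨v, hv, rfl⟩ := h.exists_mem_grading hn hg
    rw [hq1]
    refine ⟨u, hu, v, hv, Subtype.ext ?_⟩
    simp only [Subalgebra.coe_sub, coe_X_smul, mono_self, mono_zero, hfg]
    simp
  rcases (show 1 ≤ i by omega).eq_or_lt with rfl | hi
  · refine vanish_one_cons (raises_X_grading hA _) (hv _) ?_
    rintro r hr ⟨c, -, hc⟩
    have hc' := congrArg Subtype.val (sub_eq_zero.1 hc)
    rw [coe_X_smul, coe_X_smul, mono_self, mono_zero] at hc'
    rw [mem_grading_natCast, add_mul, one_mul] at hr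
    -- H_1: a relation x^d r = y^d c makes y^d divide r, and the quotient, of degree q - 1 ≥ m, is
    -- in the ring.
    obtain ⟨g, hg, hg'⟩ := exists_of_X_pow_mul_eq hr hc'
    obtain ⟨v, hv, rfl⟩ := h.exists_mem_grading hn hg
    rw [hq1]
    refine ⟨v, hv, Subtype.ext ?_⟩
    simp only [Subalgebra.coe_sub, coe_X_smul, mono_zero, hg']
    simp
  rcases (show 2 ≤ i by omega).eq_or_lt with rfl | hi
  · exact vanish_cons_of_vanish (raises_X_grading hA _) (vanish_of_length_lt (by simp)) (hv _)
  · exact vanish_of_length_lt (by simpa using hi)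

/-- Some element of degree `m` is not in the ideal `Q`, though all the forms from degree `m` on
are in the ring: then the regularity is `m`. -/
theorem Saturated.hasRegularity [Finite A] (h : Saturated k d A m) (hA : ∀ α ∈ A, α ≤ d)
    (hm : 1 ≤ m) (h0 : 0 ∈ A) (hd : d ∈ A) (hd0 : 0 < d) {w : ring k d A}
    (hw : w ∈ grading k d A m) (hwQ : w ∉ idealQ k d A h0 hd) :
    HasRegularity (presentation k d A) (component k d A) m := by
  classical
  cases nonempty_fintype A
  let u : A := ⟨d, hd⟩
  let v : A := ⟨0, h0⟩
  have huv : u ≠ v := fun h => hd0.ne' (congrArg Subtype.val h)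
  -- The two parameters come last, so that `vanish_append` adds the remaining variables in front of
  -- them.
  let l : List A := (Finset.univ \ {u, v}).toList ++ [u, v]
  have hl : l.Nodup := by
    refine List.nodup_append.2 ⟨Finset.nodup_toList _, by simp [huv], ?_⟩
    rintro a ha b hb rfl
    simp at ha hb
    tauto
  have hl' (s : A) : s ∈ l := by
    simp only [l, List.mem_append, Finset.mem_toList, Finset.mem_sdiff, Finset.mem_univ, true_and,
      Finset.mem_insert, Finset.mem_singleton, List.mem_cons, List.not_mem_nil, or_false]
    tauto
  have hnot : ¬ Vanish (varList k [u, v]) (grading k d A) 0 m := by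
    rw [vanish_zero_iff]
    intro hz
    obtain ⟨c, -, c', -, hc⟩ := hz w hw
    refine hwQ (Ideal.mem_span_pair.2 ⟨c, c', ?_⟩)
    have hc' : w - X u • c - X v • c' = 0 := hc
    rw [presentation_smul, presentation_smul, presentation_X, presentation_X, sub_sub,
      sub_eq_zero] at hc'
    rw [hc', mul_comm c, mul_comm c']
  obtain ⟨H, H'⟩ := vanish_append (varList k (Finset.univ \ {u, v}).toList) (fun y hy => by
    obtain ⟨s, -, rfl⟩ := List.mem_map.1 hy
    exact raises_X_grading hA s) (h.vanish hA hm h0 hd) hnot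
  refine hasRegularity_of_vanish (φ := presentation k d A) (𝒜 := component k d A)
    (γ := grading k d A) (l := l) (fun f r => presentation_smul f r)
    (fun n r => mem_component) (fun p q f hf r hr => presentation_mul_mem_grading hA p q f hf r hr)
    (iSupIndep_grading hd0) ?_ presentation_surjective (fun f hf => ?_) hl hl' ?_ ?_
  · have : (1 : ring k d A) ∈ grading k d A (0 : ℕ) := mem_grading_natCast.2 (by
      rw [Nat.zero_mul]; exact isHomogeneous_one (Fin 2) k)
    exact_mod_cast this
  · rw [← constantCoeff_presentation hd0, hf]
    simp
  · simpa only [varList, l, List.map_append] using H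
  · simpa only [varList, l, List.map_append] using H'

theorem irrelevant_pow_le (r : ℕ) :
    irrelevant k d A ^ r ≤ Ideal.span {f | ∃ n : ℕ, r ≤ n ∧ f ∈ component k d A n} := by
  induction r with
  | zero =>
    rw [pow_zero, Ideal.one_eq_top, top_le_iff, Ideal.eq_top_iff_one]
    refine Ideal.subset_span ⟨0, le_rfl, mem_component.2 (mem_grading_natCast.2 ?_)⟩
    rw [zero_mul]
    exact isHomogeneous_one (Fin 2) k
  | succ r ih =>
    rw [pow_succ]
    refine (Ideal.mul_mono_left ih).trans ?_
    rw [irrelevant, Ideal.span_mul_span', Ideal.span_le]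
    rintro _ ⟨f, ⟨n, hn, hf⟩, g, ⟨n', hn', hg⟩, rfl⟩
    refine Ideal.subset_span ⟨n + n', by omega, ?_⟩
    rw [mem_component, mem_grading_natCast] at hf hg ⊢
    rw [add_mul]
    exact hf.mul hg

theorem idealQ_le (hA : ∀ α ∈ A, α ≤ d) (h0 : 0 ∈ A) (hd : d ∈ A) :
    idealQ k d A h0 hd ≤ irrelevant k d A := by
  rw [idealQ, Ideal.span_le]
  rintro _ (rfl | rfl)
  · exact generator_mem_irrelevant hA _
  · exact generator_mem_irrelevant hA _

/-- R_+^(m+1) is contained in the ideal of forms of degree at least m + 1; each such form splits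
along x^d, y^d with cofactors in R_+^m by saturation. -/
theorem Saturated.mul_pow_eq (h : Saturated k d A m) (hA : ∀ α ∈ A, α ≤ d)
    (hm : 1 ≤ m) (h0 : 0 ∈ A) (hd : d ∈ A) :
    idealQ k d A h0 hd * irrelevant k d A ^ m = irrelevant k d A ^ (m + 1) := by
  refine le_antisymm ?_ ((irrelevant_pow_le (m + 1)).trans ?_)
  · rw [pow_succ']
    exact Ideal.mul_mono_left (idealQ_le hA h0 hd)
  · rw [Ideal.span_le]
    rintro r ⟨n, hn, hr⟩
    obtain ⟨n, rfl⟩ : ∃ n', n = n' + 1 := ⟨n - 1, by omega⟩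
    rw [mem_component, mem_grading_natCast] at hr
    obtain ⟨f, g, hf, hg, hfg⟩ := exists_split (by omega) hr
    obtain ⟨u, hu, rfl⟩ := h n (by omega) f hf
    obtain ⟨v, hv, rfl⟩ := h n (by omega) g hg
    have hr' : r = generator k d A ⟨d, hd⟩ * u + generator k d A ⟨0, h0⟩ * v := by
      refine Subtype.ext (hfg.trans ?_)
      simp [generator, mono]
    have hle := Ideal.pow_le_pow_right (I := irrelevant k d A) (show m ≤ n by omega)
    rw [hr']
    exact add_mem (Ideal.mul_mem_mul (Ideal.subset_span (by simp)) (hle hu))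
      (Ideal.mul_mem_mul (Ideal.subset_span (by simp)) (hle hv))

/-- An equality at r < m would give R_+^m ⊆ R_+^(r+1) = Q R_+^r ⊆ Q, contrary to w. -/
theorem Saturated.reductionNumber_eq (h : Saturated k d A m) (hA : ∀ α ∈ A, α ≤ d)
    (hm : 1 ≤ m) (h0 : 0 ∈ A) (hd : d ∈ A) {w : ring k d A}
    (hw : w ∈ irrelevant k d A ^ m) (hwQ : w ∉ idealQ k d A h0 hd) :
    reductionNumber (idealQ k d A h0 hd) (irrelevant k d A) = m := by
  refine le_antisymm (Nat.sInf_le (h.mul_pow_eq hA hm h0 hd))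
    (le_csInf ⟨m, h.mul_pow_eq hA hm h0 hd⟩ fun r hr => ?_)
  by_contra hrm
  apply hwQ
  have h1 : w ∈ irrelevant k d A ^ (r + 1) := Ideal.pow_le_pow_right (by omega) hw
  rw [← show idealQ k d A h0 hd * irrelevant k d A ^ r = irrelevant k d A ^ (r + 1) from hr] at h1
  exact Ideal.mul_le_left h1

end Parameters

/-! ### The ring of the three intervals -/

theorem threeIntervals_le {a b c d e : ℕ} (hab : a < b) (hbc : b ≤ c) (hce : c < e) (hed : e < d) :
    ∀ α ∈ threeIntervals a b c d e, α ≤ d := by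
  rintro α ((⟨-, h⟩ | ⟨-, h⟩) | ⟨-, h⟩) <;> omega

theorem saturated_threeIntervals (k : Type*) [Field k] {a b c d e m : ℕ} (hab : a < b)
    (hbc : b ≤ c) (hce : c < e) (hed : e < d) (hend : a ≤ d - e) (hgap : e - c ≤ b - a)
    (hm : b ≤ m * a + 1) : Saturated k d (threeIntervals a b c d e) m := fun _ hn _ hf =>
  exists_of_isHomogeneous (threeIntervals_le hab hbc hce hed)
    (fun _ hi => sumOf_of_le hab hbc hce hed hend hgap hm hn hi) hf

/-- The monomial `x ^ (n * a + 1) * y ^ ((n + 1) * d - (n * a + 1))` is not in `Q` if `n * a + 1`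
is in the gap between `n * a` and `b`. -/
theorem not_mem_idealQ {k : Type*} [Field k] {a b c d e n : ℕ} (hab : a < b)
    (hbc : b ≤ c) (hce : c < e) (hed : e < d) (hn : n * a + 1 < b)
    {w : ring k d (threeIntervals a b c d e)}
    (hw : (w : MvPolynomial (Fin 2) k) = X 0 ^ (n * a + 1) * X 1 ^ ((n + 1) * d - (n * a + 1))) :
    w ∉ idealQ k d (threeIntervals a b c d e) (zero_mem_threeIntervals a b c d e)
      (last_mem_threeIntervals a b c hed) := by
  classical
  intro h
  obtain ⟨u, v, huv⟩ := Ideal.mem_span_pair.1 h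
  have h1 := congrArg Subtype.val huv
  simp only [Subalgebra.coe_add, Subalgebra.coe_mul, generator, mono_self, mono_zero] at h1
  rw [hw, X_pow_eq_monomial, X_pow_eq_monomial, X_pow_eq_monomial, X_pow_eq_monomial,
    monomial_mul, mul_one] at h1
  have h2 := congrArg (coeff (Finsupp.single 0 (n * a + 1) +
    Finsupp.single 1 ((n + 1) * d - (n * a + 1)))) h1
  -- The multiple of x^d contributes nothing, because na + 1 < b < d; the coefficient 1 must come
  -- from v times y^d.
  rw [coeff_monomial, if_pos rfl, coeff_add, coeff_mul_monomial', coeff_mul_monomial', if_neg,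
    zero_add] at h2
  · split_ifs at h2 with h3
    · rw [Finsupp.single_le_iff] at h3
      simp only [Finsupp.add_apply, Finsupp.single_apply, zero_ne_one, if_false, if_true,
        zero_add] at h3
      rw [mul_one] at h2
      -- The corresponding monomial of v has total degree nd, so n' = n, and its x-exponent na + 1
      -- is neither at most na nor at least b.
      obtain ⟨n', hn', hn''⟩ := support_of_mem_ring hbc hce hed hab v.2 _
        (ne_of_eq_of_ne h2 one_ne_zero)
      simp only [Finsupp.tsub_apply, Finsupp.add_apply, Finsupp.single_apply, zero_ne_one,
        one_ne_zero, if_false, if_true, zero_add, add_zero, tsub_zero] at hn' hn''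
      have h4 : n * d = n' * d := by
        rw [← hn', add_mul, one_mul]
        rw [add_mul, one_mul] at h3
        omega
      have h5 : n = n' := Nat.eq_of_mul_eq_mul_right (by omega) h4
      subst h5
      omega
    · exact zero_ne_one h2
  · rw [Finsupp.single_le_iff]
    simp only [Finsupp.add_apply, Finsupp.single_apply, one_ne_zero, if_false, if_true, add_zero]
    omega

end MonomialCurve

theorem mainTheorem8 (k : Type*) [Field k] (a b c d e : ℕ)
    (ha : 1 ≤ a) (hab : a < b) (hbc : b ≤ c) (hce : c < e) (hed : e < d)
    (hend : a ≤ d - e) (hgap : e - c ≤ b - a) :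
    let A : Set ℕ := MonomialCurve.threeIntervals a b c d e
    let Q := MonomialCurve.idealQ k d A (MonomialCurve.zero_mem_threeIntervals a b c d e)
      (MonomialCurve.last_mem_threeIntervals a b c hed)
    let Rplus := MonomialCurve.irrelevant k d A
    IsReduction Q Rplus ∧
    (reductionNumber Q Rplus : ℤ) = ⌈((b : ℚ) - 1) / (a : ℚ)⌉ ∧
    HasRegularity (MonomialCurve.presentation k d A) (MonomialCurve.component k d A)
      ⌈((b : ℚ) - 1) / (a : ℚ)⌉ := by
  intro A Q Rplus
  -- This n is m - 1. Dividing b - 2, rather than b - 1, by a makes the first inequality strict and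
  -- allows equality in the second, as the ceiling requires.
  obtain ⟨n, hn, hn'⟩ : ∃ n, n * a + 1 < b ∧ b ≤ (n + 1) * a + 1 := by
    have h1 := Nat.div_mul_le_self (b - 2) a
    have h2 : b - 2 < ((b - 2) / a + 1) * a := by
      rw [← Nat.div_lt_iff_lt_mul ha]; exact Nat.lt_succ_self _
    exact ⟨(b - 2) / a, by omega, by omega⟩
  have hceil : ⌈((b : ℚ) - 1) / (a : ℚ)⌉ = ((n + 1 : ℕ) : ℤ) := by
    have ha' : (0 : ℚ) < a := by exact_mod_cast ha
    have hn1 : (n : ℚ) * a + 1 < b := by exact_mod_cast hn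
    have hn2 : (b : ℚ) ≤ (n + 1) * a + 1 := by exact_mod_cast hn'
    rw [Int.ceil_eq_iff, lt_div_iff₀ ha', div_le_iff₀ ha']
    push_cast
    constructor <;> linarith
  have hA := MonomialCurve.threeIntervals_le hab hbc hce hed
  have hsat := MonomialCurve.saturated_threeIntervals k hab hbc hce hed hend hgap hn'
  have hle : n * a + 1 ≤ (n + 1) * d := by
    rw [add_mul, one_mul]
    omega
  -- Saturation in degree n + 1 itself puts the monomial into R_+^(n+1).
  obtain ⟨w, hw, hw'⟩ := hsat (n + 1) le_rfl
    (MvPolynomial.X 0 ^ (n * a + 1) * MvPolynomial.X 1 ^ ((n + 1) * d - (n * a + 1))) (by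
      have := (MvPolynomial.isHomogeneous_X_pow (R := k) (0 : Fin 2) (n * a + 1)).mul
        (MvPolynomial.isHomogeneous_X_pow 1 ((n + 1) * d - (n * a + 1)))
      rwa [Nat.add_sub_cancel' hle] at this)
  have hwQ := MonomialCurve.not_mem_idealQ hab hbc hce hed hn hw'
  have hwg : w ∈ MonomialCurve.grading k d A (n + 1 : ℕ) := by
    rw [MonomialCurve.mem_grading_natCast, hw']
    have := (MvPolynomial.isHomogeneous_X_pow (R := k) (0 : Fin 2) (n * a + 1)).mul
        (MvPolynomial.isHomogeneous_X_pow 1 ((n + 1) * d - (n * a + 1)))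
    rwa [Nat.add_sub_cancel' hle] at this
  have : Finite A := (Set.finite_Iic d).subset hA
  rw [hceil]
  exact ⟨⟨MonomialCurve.idealQ_le hA _ _, n + 1, hsat.mul_pow_eq hA (by omega) _ _⟩,
    by rw [hsat.reductionNumber_eq hA (by omega) _ _ hw hwQ],
    hsat.hasRegularity hA (by omega) _ _ (by omega) hwg hwQ⟩
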